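/- **Setting.** Let $(V,E)$ be a finite simple graph, $S\subseteq V$ a set of terminals with $|S|\ge 3$, and let $u:E\to\mathbb Z_+$ (edge-capacity), $a:E\to\mathbb Z_+$ with $a_e>0$ for all $e$ (edge-cost), $c:V\setminus S\to\mathbb Z_+$ (node-capacity) and $r:S\to\mathbb Z_+$ (requirement) be given. Write $\mathbb Z^*=\tfrac12\mathbb Z$ and $(x)^+=\max\{x,0\}$. **The space.** In $(\mathbb Z^*)^S$ put $\mathbb C=\{T: T_s\ge 0\ \forall s\in S\}$, $\mathbb W_s=\{T: T_s\ge 0,\ T_t=T_{t'}\le 0\ \forall t,t'\in S\setminus\{s\}\}$ and $\overline{\mathbb S}=\mathbb C\cup\bigcup_{s\in S}\mathbb W_s$. Two elements of $\overline{\mathbb S}$ are adjacent if both lie in $\mathbb C$ and they differ in exactly one coordinate, by $\tfrac12$; or both lie in some $\mathbb W_s$ and either they differ only in the coordinate $s$, by $\tfrac12$, or they have the same coordinate $s$ and the common values of the other coordinates differ by $\tfrac12$. An edge $TT'$ is oriented $T\swarrow T'$ ($T$ below $T'$) if the changing coordinates of $T$ are integers. Let $\mathbb G=\prod_{s\in S}\mathbb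 W_s\times\prod_{i\in V\setminus S}\overline{\mathbb S}$, the Cartesian product of these oriented graphs, where $\mathbb W_s\subseteq\overline{\mathbb S}$ carries the induced oriented graph. **The function.** For $T,T'\in\overline{\mathbb S}$ and an integer $b\ge 0$ define (the values do not depend on the choice of $t\ne s$) - $B(T)=0$ if $T\in\mathbb C$, and $B(T)=(-T_s-T_t)^+$ if $T\in\mathbb W_s$, $t\neq s$; - $\mathrm{size}(T)=\sum_{s}T_s$ if $T\in\mathbb C$, and $\mathrm{size}(T)=(T_s+T_t)^+$ if $T\in\mathbb W_s$, $t\ne s$; - $\mathrm{dist}_b(T,T')$, symmetric in $T,T'$: it is $0$ if $T,T'\in\mathbb C$; $(-T_t-T'_s-b)^+$ if $T\in\mathbb W_s$, $T'\in\mathbb C\cup\mathbb W_t$, $s\neq t$; and $(-T_s-T'_t-b)^++(-T_t-T'_s-b)^+$ if $T,T'\in\mathbb W_s$, $t\ne s$. For $M\in\mathbb R$ define $\tilde h=\tilde h_M:\mathbb G\to\mathbb R$ by $$\tilde h(p)=-\sum_{s\in S}r_s\,\mathrm{dist}_0(0,p_s)+\sum_{i\in V\setminus S}c_i\,\mathrm{size}(p_i)+\sum_{ij\in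 E}u_{ij}\,\mathrm{dist}_{a_{ij}}(p_i,p_j)+M\Big(\sum_{s\in S}\big(B(p_s)+\mathrm{size}(p_s)\big)+\sum_{i\in V\setminus S}B(p_i)\Big).$$ **Notions.** An oriented graph is a *well-oriented median graph* if it is connected; for all $u,v,w$ exactly one node lies on shortest paths between each two of $u,v,w$; in every 4-cycle $(u_1,u_2,u_3,u_4)$, $u_2\swarrow u_1$ implies $u_3\swarrow u_4$; and, with $\preceq$ the reflexive and transitive closure of $\swarrow$, every interval $[u,v]=\{w:u\preceq w\preceq v\}$ with $u\preceq v$ is a Boolean lattice. For $u\preceq v$ let $r[u,v]=r[v,u]$ be the maximum $\ell$ for which there is a chain $u=c_0\prec c_1\prec\dots\prec c_\ell=v$. A non-comparable pair $(u,v)$ that is bounded below is *$\wedge$-antipodal* if $r[a,u]\,r[b,v]\ge r[u\wedge v,a]\,r[u\wedge v,b]$ for all pairs $(a,b)$ bounded above with $u\succeq a\succeq u\wedge v\preceq b\preceq v$; *$\vee$-antipodal* pairs are defined dually. A real function $f$ on the nodes of a well-oriented median graph is *L-convex* if 1. for every pair $(u,v)$ bounded above and below, $u\wedge v$ and $u\vee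 v$ exist and $f(u)+f(v)\ge f(u\wedge v)+f(u\vee v)$; 2. for every $\wedge$-antipodal pair $(u,v)$, $r[u\wedge v,v]f(u)+r[u\wedge v,u]f(v)\ge (r[u\wedge v,u]+r[u\wedge v,v])f(u\wedge v)$; 3. for every $\vee$-antipodal pair $(u,v)$, the inequality of 2 holds with $\wedge$ replaced by $\vee$. **Proposition.** $\mathbb G$ is a well-oriented median graph, and there is a real number $M_0$, which may depend on $(V,E),S,u,a,c,r$, such that for every $M\ge M_0$ the function $\tilde h_M:\mathbb G\to\mathbb R$ is L-convex. -/

import Mathlib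

/-! ## Oriented graphs, well-oriented median graphs, and L-convex functions -/

/-- A simple graph together with an orientation of its edges.
`G.below u v` says that `uv` is an edge which is oriented `u ↙ v`, so `u` is its lower end. -/
structure OrientedGraph (α : Type*) where
  graph : SimpleGraph α
  below : α → α → Prop
  adj_iff : ∀ u v, graph.Adj u v ↔ below u v ∨ below v u
  asymm : ∀ u v, below u v → ¬ below v u

namespace OrientedGraph

/-- The subgraph induced on a set of nodes, with the restricted orientation. -/
def induce {α : Type*} (G : OrientedGraph α) (A : Set α) : OrientedGraph A where
  graph := G.graph.induce A
  below u v := G.below u v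
  adj_iff u v := by simpa using G.adj_iff u v
  asymm u v h := G.asymm u v h

/-- The Cartesian product of oriented graphs: an edge changes exactly one component, along an
edge of the corresponding factor, and inherits its orientation. -/
def pi {I : Type*} {α : I → Type*} (G : ∀ i, OrientedGraph (α i)) :
    OrientedGraph (∀ i, α i) where
  graph :=
    { Adj := fun p q => ∃ i, (G i).graph.Adj (p i) (q i) ∧ ∀ j, j ≠ i → p j = q j
      symm := ⟨fun p q ⟨i, h, h'⟩ => ⟨i, h.symm, fun j hj => (h' j hj).symm⟩⟩
      loopless := ⟨fun p ⟨i, h, _⟩ => (G i).graph.loopless.irrefl _ h⟩ }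
  below p q := ∃ i, (G i).below (p i) (q i) ∧ ∀ j, j ≠ i → p j = q j
  adj_iff p q := by
    constructor
    · rintro ⟨i, h, h'⟩
      rcases ((G i).adj_iff _ _).1 h with h | h
      · exact Or.inl ⟨i, h, h'⟩
      · exact Or.inr ⟨i, h, fun j hj => (h' j hj).symm⟩
    · rintro (⟨i, h, h'⟩ | ⟨i, h, h'⟩)
      · exact ⟨i, ((G i).adj_iff _ _).2 (Or.inl h), h'⟩
      · exact ⟨i, ((G i).adj_iff _ _).2 (Or.inr h), fun j hj => (h' j hj).symm⟩
  asymm p q := by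
    rintro ⟨i, h, h'⟩ ⟨j, g, g'⟩
    by_cases hij : i = j
    · subst hij
      exact (G i).asymm _ _ h g
    · have e : q i = p i := g' i hij
      rw [e] at h
      exact (G i).asymm _ _ h h

variable {α : Type*} (G : OrientedGraph α)

/-- The metric interval `I(u,v)` of the shortest path metric. -/
def metricInterval (u v : α) : Set α :=
  {w | G.graph.dist u v = G.graph.dist u w + G.graph.dist w v}

/-- A median graph: connected, and `I(u,v) ∩ I(v,w) ∩ I(w,u)` is always a singleton. -/
def IsMedian : Prop :=
  G.graph.Connected ∧ ∀ u v w : α,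
    ∃! x, x ∈ G.metricInterval u v ∩ G.metricInterval v w ∩ G.metricInterval w u

/-- The orientation is admissible: opposite edges of a 4-cycle are oriented alike. -/
def IsAdmissible : Prop :=
  ∀ u₁ u₂ u₃ u₄ : α, G.graph.Adj u₁ u₂ → G.graph.Adj u₂ u₃ → G.graph.Adj u₃ u₄ →
    G.graph.Adj u₄ u₁ → u₁ ≠ u₃ → u₂ ≠ u₄ → G.below u₂ u₁ → G.below u₃ u₄

/-- The order `⪯`: reflexive and transitive closure of the orientation. -/
def le (u v : α) : Prop := Relation.ReflTransGen G.below u v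

/-- The strict order `≺`. -/
def lt (u v : α) : Prop := G.le u v ∧ u ≠ v

/-- A well-oriented median graph: a median graph with an admissible orientation, all of whose
order intervals `[u,v]` (with `u ⪯ v`) are Boolean lattices. -/
def IsWellOrientedMedian : Prop :=
  G.IsMedian ∧ G.IsAdmissible ∧ ∀ u v : α, G.le u v →
    ∃ b : BooleanAlgebra {w : α // G.le u w ∧ G.le w v},
      ∀ x y : {w : α // G.le u w ∧ G.le w v}, b.le x y ↔ G.le x.1 y.1

/-- `(u,v)` is bounded above. -/
def UpperBounded (u v : α) : Prop := ∃ w, G.le u w ∧ G.le v w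

/-- `(u,v)` is bounded below. -/
def LowerBounded (u v : α) : Prop := ∃ w, G.le w u ∧ G.le w v

/-- `m` is the meet `u ∧ v`. -/
def IsMeet (u v m : α) : Prop :=
  G.le m u ∧ G.le m v ∧ ∀ w, G.le w u → G.le w v → G.le w m

/-- `j` is the join `u ∨ v`. -/
def IsJoin (u v j : α) : Prop :=
  G.le u j ∧ G.le v j ∧ ∀ w, G.le u w → G.le v w → G.le j w

/-- `r[u,v]` for `u ⪯ v`: the maximum length `ℓ` of a chain `u = c₀ ≺ c₁ ≺ ⋯ ≺ c_ℓ = v`. -/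
noncomputable def rank (u v : α) : ℕ :=
  sSup {l : ℕ | ∃ c : Fin (l + 1) → α, c 0 = u ∧ c (Fin.last l) = v ∧
    ∀ i : Fin l, G.lt (c i.castSucc) (c i.succ)}

/-- `(u,v)` is a `∧`-antipodal pair, and `m` is its meet. -/
def IsMeetAntipodal (u v m : α) : Prop :=
  ¬ G.le u v ∧ ¬ G.le v u ∧ G.IsMeet u v m ∧
    ∀ a b, G.le a u → G.le m a → G.le m b → G.le b v → G.UpperBounded a b →
      G.rank a u * G.rank b v ≥ G.rank m a * G.rank m b

/-- `(u,v)` is a `∨`-antipodal pair, and `j` is its join. -/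
def IsJoinAntipodal (u v j : α) : Prop :=
  ¬ G.le u v ∧ ¬ G.le v u ∧ G.IsJoin u v j ∧
    ∀ a b, G.le u a → G.le a j → G.le b j → G.le v b → G.LowerBounded a b →
      G.rank u a * G.rank v b ≥ G.rank a j * G.rank b j

/-- L-convexity of a function on (the nodes of) a well-oriented median graph: submodularity on
pairs bounded above and below, and convexity across the meet (the join) of every
`∧`-antipodal (`∨`-antipodal) pair. -/
def LConvex (f : α → ℝ) : Prop :=
  (∀ u v, G.UpperBounded u v → G.LowerBounded u v →
    ∃ m j, G.IsMeet u v m ∧ G.IsJoin u v j ∧ f u + f v ≥ f m + f j) ∧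
  (∀ u v m, G.IsMeetAntipodal u v m →
    (G.rank m v : ℝ) * f u + (G.rank m u : ℝ) * f v
      ≥ ((G.rank m u : ℝ) + (G.rank m v : ℝ)) * f m) ∧
  (∀ u v j, G.IsJoinAntipodal u v j →
    (G.rank v j : ℝ) * f u + (G.rank u j : ℝ) * f v
      ≥ ((G.rank u j : ℝ) + (G.rank v j : ℝ)) * f j)

end OrientedGraph

/-! ## The extended subtree space -/

namespace SubtreeSpace

/-! Half-integers (elements of `ℤ/2`) are stored by their double: the code `n : ℤ` stands for the
half-integer `n/2`. Thus `n` stands for an integer iff `n` is even, the sign conditions read the same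
on codes, and two half-integers differ by `1/2` iff their codes differ by `1`. -/

/-- The real number `n/2` that the code `n` stands for. -/
noncomputable def val (n : ℤ) : ℝ := (n : ℝ) / 2

section Space

variable {ι : Type*}

/-- The set `ℂ` of vectors with `T_s ≥ 0` for all `s`. -/
def C (ι : Type*) : Set (ι → ℤ) := {T | ∀ s, 0 ≤ T s}

/-- The set `𝕎_s` of vectors with `T_s ≥ 0` and `T_t = T_t' ≤ 0` for all `t, t' ≠ s`. -/
def W (s : ι) : Set (ι → ℤ) :=
  {T | 0 ≤ T s ∧ ∀ t t', t ≠ s → t' ≠ s → T t = T t' ∧ T t ≤ 0}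

/-- The extended subtree space, the union of `ℂ` and all `𝕎_s`. -/
def Sbar (ι : Type*) : Set (ι → ℤ) := {T | T ∈ C ι ∨ ∃ s, T ∈ W s}

/-- An edge of the grid graph on `ℂ`: exactly one coordinate changes, by `1/2`. -/
def CEdge (T T' : ι → ℤ) : Prop :=
  T ∈ C ι ∧ T' ∈ C ι ∧ ∃ s, |T s - T' s| = 1 ∧ ∀ t, t ≠ s → T t = T' t

/-- An edge of the grid graph on `𝕎_s`, with the two grid coordinates `T_s` and
the common value of the `T_t` for `t ≠ s`: exactly one of these two changes, by `1/2`. -/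
def WEdge (s : ι) (T T' : ι → ℤ) : Prop :=
  T ∈ W s ∧ T' ∈ W s ∧
    ((|T s - T' s| = 1 ∧ ∀ t, t ≠ s → T t = T' t) ∨
      (T s = T' s ∧ ∀ t, t ≠ s → |T t - T' t| = 1))

/-- The amalgam of the grid graphs on `ℂ` and on the `𝕎_s`. -/
def sbarGraph (ι : Type*) : SimpleGraph (Sbar ι) where
  Adj T T' := T ≠ T' ∧ (CEdge T.1 T'.1 ∨ ∃ s, WEdge s T.1 T'.1)
  symm := ⟨by
    rintro T T' ⟨hne, h⟩
    refine ⟨hne.symm, ?_⟩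
    rcases h with ⟨h1, h2, s, h3, h4⟩ | ⟨s, h1, h2, h3⟩
    · exact Or.inl ⟨h2, h1, s, by rw [abs_sub_comm]; exact h3, fun t ht => (h4 t ht).symm⟩
    · refine Or.inr ⟨s, h2, h1, ?_⟩
      rcases h3 with ⟨h3, h4⟩ | ⟨h3, h4⟩
      · exact Or.inl ⟨by rw [abs_sub_comm]; exact h3, fun t ht => (h4 t ht).symm⟩
      · exact Or.inr ⟨h3.symm, fun t ht => by rw [abs_sub_comm]; exact h4 t ht⟩⟩
  loopless := ⟨fun _ h => h.1 rfl⟩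

/-- The oriented graph of the extended subtree space: the lower end of an edge is the one whose
changing coordinate is an integer. -/
def sbarOriented (ι : Type*) : OrientedGraph (Sbar ι) where
  graph := sbarGraph ι
  below T T' := (sbarGraph ι).Adj T T' ∧ ∀ s, T.1 s ≠ T'.1 s → Even (T.1 s)
  adj_iff T T' := by
    refine ⟨fun h => ?_, fun h => h.elim (fun h => h.1) (fun h => h.1.symm)⟩
    have key : (∀ s, T.1 s ≠ T'.1 s → Even (T.1 s)) ∨ (∀ s, T'.1 s ≠ T.1 s → Even (T'.1 s)) := by
      have single : ∀ s, |T.1 s - T'.1 s| = 1 → (∀ t, t ≠ s → T.1 t = T'.1 t) →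
          (∀ s, T.1 s ≠ T'.1 s → Even (T.1 s)) ∨ (∀ s, T'.1 s ≠ T.1 s → Even (T'.1 s)) := by
        intro s h3 h4
        rcases Int.even_or_odd (T.1 s) with he | ho
        · left
          intro t ht
          by_cases hts : t = s
          · rw [hts]; exact he
          · exact absurd (h4 t hts) ht
        · right
          intro t ht
          by_cases hts : t = s
          · subst hts
            rcases (abs_eq (by norm_num : (0 : ℤ) ≤ 1)).1 h3 with h | h
            · have e : T'.1 t = T.1 t - 1 := by omega
              rw [e]; exact ho.sub_odd odd_one
            · have e : T'.1 t = T.1 t + 1 := by omega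
              rw [e]; exact ho.add_odd odd_one
          · exact absurd (h4 t hts).symm ht
      rcases h.2 with ⟨_, _, s, h3, h4⟩ | ⟨s, h1, h2, ⟨h3, h4⟩ | ⟨h3, h4⟩⟩
      · exact single s h3 h4
      · exact single s h3 h4
      · by_cases hex : ∃ t, t ≠ s
        · obtain ⟨t₀, ht₀⟩ := hex
          have ne_s : ∀ t, T.1 t ≠ T'.1 t → t ≠ s := fun t ht hts => ht (hts ▸ h3)
          rcases Int.even_or_odd (T.1 t₀) with he | ho
          · left
            intro t ht
            rw [(h1.2 t t₀ (ne_s t ht) ht₀).1]; exact he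
          · right
            intro t ht
            rw [(h2.2 t t₀ (ne_s t ht.symm) ht₀).1]
            rcases (abs_eq (by norm_num : (0 : ℤ) ≤ 1)).1 (h4 t₀ ht₀) with h | h
            · have e : T'.1 t₀ = T.1 t₀ - 1 := by omega
              rw [e]; exact ho.sub_odd odd_one
            · have e : T'.1 t₀ = T.1 t₀ + 1 := by omega
              rw [e]; exact ho.add_odd odd_one
        · left
          intro t ht
          exact absurd ⟨t, fun hts => ht (hts ▸ h3)⟩ hex
    exact key.imp (fun k => ⟨h, k⟩) (fun k => ⟨h.symm, k⟩)
  asymm T T' := by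
    rintro ⟨h, k⟩ ⟨_, k'⟩
    obtain ⟨s, hs⟩ := Function.ne_iff.1 (fun e => h.1 (Subtype.ext e) : T.1 ≠ T'.1)
    have hd : |T.1 s - T'.1 s| = 1 := by
      rcases h.2 with ⟨_, _, s', h3, h4⟩ | ⟨s', _, _, ⟨h3, h4⟩ | ⟨h3, h4⟩⟩
      · by_cases e : s = s'
        · rw [e]; exact h3
        · exact absurd (h4 s e) hs
      · by_cases e : s = s'
        · rw [e]; exact h3
        · exact absurd (h4 s e) hs
      · by_cases e : s = s'
        · exact absurd (e ▸ h3) hs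
        · exact h4 s e
    have h1 := k s hs
    have h2 := k' s hs.symm
    have h3 := h1.sub h2
    rcases (abs_eq (by norm_num : (0 : ℤ) ≤ 1)).1 hd with h | h <;> rw [h] at h3 <;>
      exact absurd h3 (by decide)

/-! ### The functions `B`, `size` and `dist_a`

They are given by cases. The cases overlap and some of them involve an arbitrary index `t ≠ s`;
the lemmas below show that the value does not depend on the choices. -/

open Classical in
/-- The barrier function: `0` on `ℂ`, and `(-T_s - T_t)⁺` on `𝕎_s`, for any `t ≠ s`. -/
noncomputable def barrier (T : ι → ℤ) : ℝ :=
  if T ∈ C ι then 0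
  else if h : ∃ q : ι × ι, q.1 ≠ q.2 ∧ T ∈ W q.1 then
    max (-val (T h.choose.1) - val (T h.choose.2)) 0
  else 0

open Classical in
/-- The size: the sum of the `T_s` on `ℂ`, and `(T_s + T_t)⁺` on `𝕎_s`, for any `t ≠ s`. -/
noncomputable def size [Fintype ι] (T : ι → ℤ) : ℝ :=
  if T ∈ C ι then ∑ s, val (T s)
  else if h : ∃ q : ι × ι, q.1 ≠ q.2 ∧ T ∈ W q.1 then
    max (val (T h.choose.1) + val (T h.choose.2)) 0
  else 0

open Classical in
/-- The function `dist_a`, a symmetric function of two elements of the extended subtree space: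
`0` if both arguments are in `ℂ`;
`(-T_s - T'_t - a)⁺ + (-T_t - T'_s - a)⁺` if both are in `𝕎_s`, for any `t ≠ s`;
`(-T_t - T'_s - a)⁺` if `T ∈ 𝕎_s` and `T' ∈ ℂ ∪ 𝕎_t` where `s ≠ t`, and symmetrically. -/
noncomputable def dist (a : ℕ) (T T' : ι → ℤ) : ℝ :=
  if T ∈ C ι ∧ T' ∈ C ι then 0
  else if h : ∃ q : ι × ι, q.1 ≠ q.2 ∧ T ∈ W q.1 ∧ T' ∈ W q.1 then
    max (-val (T h.choose.1) - val (T' h.choose.2) - a) 0 +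
      max (-val (T h.choose.2) - val (T' h.choose.1) - a) 0
  else if h : ∃ q : ι × ι, q.1 ≠ q.2 ∧ T ∈ W q.1 ∧ (T' ∈ C ι ∨ T' ∈ W q.2) then
    max (-val (T h.choose.2) - val (T' h.choose.1) - a) 0
  else if h : ∃ q : ι × ι, q.1 ≠ q.2 ∧ T' ∈ W q.1 ∧ (T ∈ C ι ∨ T ∈ W q.2) then
    max (-val (T' h.choose.2) - val (T h.choose.1) - a) 0
  else 0

theorem mem_C_of_mem_W_of_mem_W {T : ι → ℤ} {s s' : ι} (hs : s ≠ s') (h : T ∈ W s)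
    (h' : T ∈ W s') : T ∈ C ι := by
  intro x
  by_cases hx : x = s
  · rw [hx]; exact h.1
  · rw [(h.2 x s' hx hs.symm).1]; exact h'.1

theorem barrier_of_mem_C {T : ι → ℤ} (h : T ∈ C ι) : barrier T = 0 := if_pos h

theorem barrier_of_mem_W {T : ι → ℤ} {s t : ι} (hst : s ≠ t) (h : T ∈ W s) :
    barrier T = max (-val (T s) - val (T t)) 0 := by
  have hex : ∃ q : ι × ι, q.1 ≠ q.2 ∧ T ∈ W q.1 := ⟨(s, t), hst, h⟩
  unfold barrier
  by_cases hC : T ∈ C ι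
  · rw [if_pos hC, max_eq_right]
    have h1 : (0 : ℝ) ≤ (T s : ℝ) := by exact_mod_cast hC s
    have h2 : (0 : ℝ) ≤ (T t : ℝ) := by exact_mod_cast hC t
    unfold val; linarith
  · rw [if_neg hC, dif_pos hex]
    obtain ⟨hne, hW⟩ := hex.choose_spec
    have e : hex.choose.1 = s := by
      by_contra hn; exact hC (mem_C_of_mem_W_of_mem_W hn hW h)
    rw [e, (h.2 hex.choose.2 t (fun k => hne (e.trans k.symm)) hst.symm).1]

theorem size_of_mem_C [Fintype ι] {T : ι → ℤ} (h : T ∈ C ι) : size T = ∑ s, val (T s) := if_pos h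

theorem size_of_mem_W [Fintype ι] {T : ι → ℤ} {s t : ι} (hst : s ≠ t) (h : T ∈ W s) :
    size T = max (val (T s) + val (T t)) 0 := by
  classical
  have hex : ∃ q : ι × ι, q.1 ≠ q.2 ∧ T ∈ W q.1 := ⟨(s, t), hst, h⟩
  unfold size
  by_cases hC : T ∈ C ι
  · have h0 : ∀ x, x ≠ s → T x = 0 := fun x hx => le_antisymm (h.2 x x hx hx).2 (hC x)
    have h1 : (0 : ℝ) ≤ (T s : ℝ) := by exact_mod_cast hC s
    rw [if_pos hC, Finset.sum_eq_single s (fun x _ hx => by rw [h0 x hx]; simp [val])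
      (fun hn => absurd (Finset.mem_univ s) hn), h0 t hst.symm]
    rw [max_eq_left] <;> simp only [val] <;> push_cast <;> linarith
  · rw [if_neg hC, dif_pos hex]
    obtain ⟨hne, hW⟩ := hex.choose_spec
    have e : hex.choose.1 = s := by
      by_contra hn; exact hC (mem_C_of_mem_W_of_mem_W hn hW h)
    rw [e, (h.2 hex.choose.2 t (fun k => hne (e.trans k.symm)) hst.symm).1]

theorem dist_of_mem_C (a : ℕ) {T T' : ι → ℤ} (h : T ∈ C ι) (h' : T' ∈ C ι) : dist a T T' = 0 :=
  if_pos ⟨h, h'⟩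

theorem dist_of_mem_W (a : ℕ) {T T' : ι → ℤ} {s t : ι} (hst : s ≠ t) (h : T ∈ W s)
    (h' : T' ∈ W s) :
    dist a T T' =
      max (-val (T s) - val (T' t) - a) 0 + max (-val (T t) - val (T' s) - a) 0 := by
  have hex : ∃ q : ι × ι, q.1 ≠ q.2 ∧ T ∈ W q.1 ∧ T' ∈ W q.1 := ⟨(s, t), hst, h, h'⟩
  unfold dist
  by_cases hC : T ∈ C ι ∧ T' ∈ C ι
  · have h1 : (0 : ℝ) ≤ (T s : ℝ) := by exact_mod_cast hC.1 s
    have h2 : (0 : ℝ) ≤ (T t : ℝ) := by exact_mod_cast hC.1 t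
    have h3 : (0 : ℝ) ≤ (T' s : ℝ) := by exact_mod_cast hC.2 s
    have h4 : (0 : ℝ) ≤ (T' t : ℝ) := by exact_mod_cast hC.2 t
    have h5 : (0 : ℝ) ≤ (a : ℝ) := Nat.cast_nonneg a
    unfold val
    rw [if_pos hC, max_eq_right, max_eq_right] <;> linarith
  · rw [if_neg hC, dif_pos hex]
    obtain ⟨hne, hW, hW'⟩ := hex.choose_spec
    have e : hex.choose.1 = s := by
      by_contra hn
      exact hC ⟨mem_C_of_mem_W_of_mem_W hn hW h, mem_C_of_mem_W_of_mem_W hn hW' h'⟩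
    have ne : hex.choose.2 ≠ s := fun k => hne (e.trans k.symm)
    rw [e, (h.2 hex.choose.2 t ne hst.symm).1, (h'.2 hex.choose.2 t ne hst.symm).1]

/-- The numerical consistency of the overlapping cases. -/
theorem dist_aux (a : ℕ) {x y x' y' : ℤ} (h : x + y = x' + y' ∨ (0 ≤ x + y ∧ 0 ≤ x' + y')) :
    max (-val x - val y - a) 0 = max (-val x' - val y' - a) 0 := by
  rcases h with h | ⟨h1, h2⟩
  · have h' : (x : ℝ) + y = x' + y' := by exact_mod_cast h
    congr 1; simp only [val]; linarith
  · have h1' : (0 : ℝ) ≤ (x : ℝ) + y := by exact_mod_cast h1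
    have h2' : (0 : ℝ) ≤ (x' : ℝ) + y' := by exact_mod_cast h2
    have h5 : (0 : ℝ) ≤ (a : ℝ) := Nat.cast_nonneg a
    rw [max_eq_right, max_eq_right] <;> simp only [val] <;> linarith

theorem dist_aux_zero (a : ℕ) {x y : ℤ} (h : 0 ≤ x + y) : max (-val x - val y - a) 0 = 0 := by
  have h1' : (0 : ℝ) ≤ (x : ℝ) + y := by exact_mod_cast h
  have h5 : (0 : ℝ) ≤ (a : ℝ) := Nat.cast_nonneg a
  rw [max_eq_right]; simp only [val]; linarith

theorem dist_of_mem_W_left (a : ℕ) {T T' : ι → ℤ} {s t : ι} (hst : s ≠ t) (h : T ∈ W s)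
    (h' : T' ∈ C ι ∨ T' ∈ W t) :
    dist a T T' = max (-val (T t) - val (T' s) - a) 0 := by
  by_cases hC : T ∈ C ι ∧ T' ∈ C ι
  · rw [dist_of_mem_C a hC.1 hC.2, dist_aux_zero a (add_nonneg (hC.1 t) (hC.2 s))]
  by_cases hex : ∃ q : ι × ι, q.1 ≠ q.2 ∧ T ∈ W q.1 ∧ T' ∈ W q.1
  · obtain ⟨⟨p, q⟩, hpq, hW, hW'⟩ := hex
    simp only at hpq hW hW'
    rw [dist_of_mem_W a hpq hW hW']
    by_cases hps : p = s
    · subst hps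
      have hT' : T' ∈ C ι := h'.elim id (fun k => mem_C_of_mem_W_of_mem_W hst hW' k)
      rw [dist_aux_zero a (add_nonneg hW.1 (hT' q)), zero_add, (h.2 q t hpq.symm hst.symm).1]
    · have hT : T ∈ C ι := mem_C_of_mem_W_of_mem_W hps hW h
      have hT' : T' ∉ C ι := fun k => hC ⟨hT, k⟩
      have hWt : T' ∈ W t := h'.resolve_left hT'
      have hpt : p = t := by
        by_contra hn; exact hT' (mem_C_of_mem_W_of_mem_W hn hW' hWt)
      subst hpt
      rw [dist_aux_zero a (add_nonneg (hT q) hW'.1), add_zero, (hW'.2 q s hpq.symm hst).1]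
  · have hex' : ∃ q : ι × ι, q.1 ≠ q.2 ∧ T ∈ W q.1 ∧ (T' ∈ C ι ∨ T' ∈ W q.2) :=
      ⟨(s, t), hst, h, h'⟩
    unfold dist
    rw [if_neg hC, dif_neg hex, dif_pos hex']
    obtain ⟨hne, hW, hW'⟩ := hex'.choose_spec
    generalize hex'.choose = q at *
    obtain ⟨p, q⟩ := q
    simp only at hne hW hW' ⊢
    by_cases hps : p = s
    · subst hps
      rw [(h.2 q t hne.symm hst.symm).1]
    · have hT : T ∈ C ι := mem_C_of_mem_W_of_mem_W hps hW h
      have hT' : T' ∉ C ι := fun k => hC ⟨hT, k⟩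
      have hWt : T' ∈ W t := h'.resolve_left hT'
      have hqt : q = t := by
        by_contra hn; exact hT' (mem_C_of_mem_W_of_mem_W hn (hW'.resolve_left hT') hWt)
      subst hqt
      rw [(hWt.2 p s hne hst).1]

theorem dist_comm (a : ℕ) (T T' : ι → ℤ) :
    dist a T T' = dist a T' T := by
  by_cases hC : T ∈ C ι ∧ T' ∈ C ι
  · rw [dist_of_mem_C a hC.1 hC.2, dist_of_mem_C a hC.2 hC.1]
  have hC' : ¬ (T' ∈ C ι ∧ T ∈ C ι) := fun k => hC k.symm
  by_cases h1 : ∃ q : ι × ι, q.1 ≠ q.2 ∧ T ∈ W q.1 ∧ T' ∈ W q.1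
  · obtain ⟨⟨s, t⟩, hst, hW, hW'⟩ := h1
    rw [dist_of_mem_W a hst hW hW', dist_of_mem_W a hst hW' hW, add_comm]
    congr 2 <;> ring
  have h1' : ¬ ∃ q : ι × ι, q.1 ≠ q.2 ∧ T' ∈ W q.1 ∧ T ∈ W q.1 :=
    fun ⟨q, k1, k2, k3⟩ => h1 ⟨q, k1, k3, k2⟩
  by_cases h2 : ∃ q : ι × ι, q.1 ≠ q.2 ∧ T ∈ W q.1 ∧ (T' ∈ C ι ∨ T' ∈ W q.2)
  · by_cases h3 : ∃ q : ι × ι, q.1 ≠ q.2 ∧ T' ∈ W q.1 ∧ (T ∈ C ι ∨ T ∈ W q.2)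
    · obtain ⟨⟨s, t⟩, hst, hW, hW'⟩ := h2
      obtain ⟨⟨s', t'⟩, hst', hV, hV'⟩ := h3
      simp only at hst hW hW' hst' hV hV'
      rw [dist_of_mem_W_left a hst hW hW', dist_of_mem_W_left a hst' hV hV']
      have hss : s ≠ s' := fun e => h1 ⟨(s, t), hst, hW, e ▸ hV⟩
      have e1 : T t = T s' := (hW.2 t s' hst.symm hss.symm).1
      have e2 : T' t' = T' s := (hV.2 t' s hst'.symm hss).1
      rw [e1, e2]; congr 1; ring
    · unfold dist
      rw [if_neg hC, if_neg hC', dif_neg h1, dif_neg h1', dif_pos h2, dif_neg h3, dif_pos h2]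
  · unfold dist
    rw [if_neg hC, if_neg hC', dif_neg h1, dif_neg h1', dif_neg h2]
    by_cases h3 : ∃ q : ι × ι, q.1 ≠ q.2 ∧ T' ∈ W q.1 ∧ (T ∈ C ι ∨ T ∈ W q.2)
    · rw [dif_pos h3, dif_pos h3]
    · rw [dif_neg h3, dif_neg h3, dif_neg h2]

end Space

/-! ### The product `𝔾` and the extended dual objective -/

section Product

variable {V : Type*}

/-- The factor of `𝔾` at the node `i`, inside the extended subtree space:
`𝕎_i` if `i` is a terminal, and the whole space otherwise. -/
def factor (S : Finset V) (i : V) : Set (Sbar S) := {T | ∀ h : i ∈ S, T.1 ∈ W (⟨i, h⟩ : S)}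

/-- The node set of `𝔾`. -/
abbrev Pot (S : Finset V) : Type _ := ∀ i : V, factor S i

/-- `𝔾 = ∏_{s ∈ S} 𝕎_s × ∏_{i ∉ S} (extended subtree space)`, as an oriented graph. -/
def potGraph (S : Finset V) : OrientedGraph (Pot S) :=
  OrientedGraph.pi fun i => (sbarOriented S).induce (factor S i)

/-- The vector `p_i`. -/
def Pot.at {S : Finset V} (p : Pot S) (i : V) : S → ℤ := (p i).1.1

/-- `dist_a(p_i, p_j)` for an unordered pair `e = ij`. -/
noncomputable def edgeDist {S : Finset V} (p : Pot S) (a : ℕ) (e : Sym2 V) : ℝ :=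
  Sym2.lift ⟨fun i j => dist a (p.at i) (p.at j),
    fun i j => dist_comm a (p.at i) (p.at j)⟩ e

/-- The extended dual objective of the network with edge set `E`, terminal set `S`,
edge-capacity `u`, edge-cost `a`, node-capacity `c` (used off `S`), requirement `r`, and with the
penalty coefficient `M`. -/
noncomputable def hTilde [Fintype V] [DecidableEq V] (E : SimpleGraph V) [DecidableRel E.Adj]
    (S : Finset V) (u a : Sym2 V → ℕ) (c : V → ℕ) (r : V → ℕ) (M : ℝ) (p : Pot S) : ℝ :=
  -(∑ s ∈ S, (r s : ℝ) * dist 0 0 (p.at s))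
    + ∑ i ∈ Sᶜ, (c i : ℝ) * size (p.at i)
    + ∑ e ∈ E.edgeFinset, (u e : ℝ) * edgeDist p (a e) e
    + M * (∑ s ∈ S, (barrier (p.at s) + size (p.at s)) + ∑ i ∈ Sᶜ, barrier (p.at i))

end Product

end SubtreeSpace

/-! Everything is transported to coordinates. A point of the extended subtree space is recorded by
nonnegative integers: the codes `T_s` on `ℂ`, and the pair `T_s`, `-T_t` on `𝕎_s`. The only
constraint is pairwise: two coordinates may be nonzero together iff both are of the first kind or
both belong to the same leg. This description is stable under products and under forbidding
coordinates, so `𝔾` itself is a "flag orthant" (`IsFlagOrthant`, `potGraph_isFlagOrthant`).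

In a flag orthant the graph distance is the `ℓ₁`-distance, medians are coordinatewise, `⪯` is the
coordinatewise zigzag order, the interval `[u,v]` is the power set of the set of coordinates where
`u` and `v` differ, and the rank counts these coordinates. Zero is even, so supports grow along `⪯`.
Hence whatever is assembled below a given node is admissible, and obstructions appear only when
going up.

For L-convexity, `∨`-antipodal pairs turn out to be symmetric about their join, so ordinary midpoint
convexity suffices there. For `∧`-antipodal pairs the key is `lin_of_isMeetAntipodal`: a linear
function with coefficients in `{-1,0,1}` satisfies the inequality as soon as the coefficients of any
two clashing indices have nonnegative sum. Positive parts of such functions plus constants inherit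
it. Submodularity on squares holds because each kink sits at an even value (`SquarePos.kink_le`).

Each term of `h̃` is zero or agrees locally with half a sum of such positive parts (or, for the
requirement term, is linear), and `CoordLConvex.of_local` glues these local formulas. All terms are
thus L-convex separately, and every `M ≥ 0` works. -/

/-! ## Oriented graphs of compatible nonnegative integer vectors -/

/-- The zigzag order on `ℤ`, in which every even number lies below its two odd neighbours. -/
def ZigzagLE (a b : ℤ) : Prop := a = b ∨ (a % 2 = 0 ∧ (b = a + 1 ∨ b = a - 1))

namespace ZigzagLE

theorem refl (a : ℤ) : ZigzagLE a a := Or.inl rfl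

theorem trans {a b c : ℤ} (h : ZigzagLE a b) (h' : ZigzagLE b c) : ZigzagLE a c := by
  unfold ZigzagLE at *; omega

theorem antisymm {a b : ℤ} (h : ZigzagLE a b) (h' : ZigzagLE b a) : a = b := by
  unfold ZigzagLE at *; omega

/-- Zero is even, so nothing lies strictly below it. This is why supports grow along the order. -/
theorem ne_zero {a b : ℤ} (h : ZigzagLE a b) (ha : a ≠ 0) : b ≠ 0 := by
  unfold ZigzagLE at *; omega

theorem eq_zero {a b : ℤ} (h : ZigzagLE a b) (hb : b = 0) : a = 0 := by
  unfold ZigzagLE at *; omega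

end ZigzagLE

namespace OrientedGraph

variable {α J : Type*}

/-- `φ` identifies the oriented graph `G` with the grid graph, in the zigzag orientation, on the
set of all nonnegative integer vectors whose support consists of pairwise `R`-related indices. -/
structure IsFlagOrthant (G : OrientedGraph α) (R : J → J → Prop) (φ : α → J → ℤ) : Prop where
  symm : ∀ j k, R j k → R k j
  inj : Function.Injective φ
  nonneg : ∀ u j, 0 ≤ φ u j
  -- The case `j = k` matters: `R` need not be reflexive, and an index with `¬ R j j` is one whose
  -- coordinate always vanishes.
  compat : ∀ u j k, φ u j ≠ 0 → φ u k ≠ 0 → R j k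
  surj : ∀ f : J → ℤ, (∀ j, 0 ≤ f j) → (∀ j k, f j ≠ 0 → f k ≠ 0 → R j k) → ∃ u, φ u = f
  below_iff : ∀ u v, G.below u v ↔
    ∃ j, φ u j % 2 = 0 ∧ (φ v j = φ u j + 1 ∨ φ v j = φ u j - 1) ∧ ∀ k, k ≠ j → φ u k = φ v k

/-- Cartesian products of flag orthants are flag orthants. -/
theorem IsFlagOrthant.pi {I K : Type*} {β : I → Type*} {G : ∀ i, OrientedGraph (β i)}
    {R : I → K → K → Prop} {φ : ∀ i, β i → K → ℤ} (h : ∀ i, (G i).IsFlagOrthant (R i) (φ i)) :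
    (OrientedGraph.pi G).IsFlagOrthant (fun a b : I × K => a.1 = b.1 → R a.1 a.2 b.2)
      (fun p a => φ a.1 (p a.1) a.2) where
  symm := by
    rintro ⟨i, j⟩ ⟨i', k⟩ hR (rfl : i' = i)
    exact (h i').symm _ _ (hR rfl)
  inj p q hpq := by
    funext i
    exact (h i).inj (funext fun k => congrFun hpq (i, k))
  nonneg p a := (h a.1).nonneg _ _
  compat := by
    rintro p ⟨i, j⟩ ⟨i', k⟩ hj hk (rfl : i = i')
    exact (h i).compat _ _ _ hj hk
  surj f hf hR := by
    choose p hp using fun i => (h i).surj (fun k => f (i, k)) (fun k => hf _)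
      (fun j k hj hk => hR (i, j) (i, k) hj hk rfl)
    exact ⟨p, funext fun a => congrFun (hp a.1) a.2⟩
  below_iff p q := by
    constructor
    · rintro ⟨i, hi, hi'⟩
      obtain ⟨j, h1, h2, h3⟩ := ((h i).below_iff _ _).1 hi
      refine ⟨(i, j), h1, h2, ?_⟩
      rintro ⟨i', k⟩ hne
      by_cases e : i' = i
      · subst e
        exact h3 k fun hk => hne (by rw [hk])
      · simp only [hi' i' e]
    · rintro ⟨⟨i, j⟩, h1, h2, h3⟩
      refine ⟨i, ((h i).below_iff _ _).2 ⟨j, h1, h2, fun k hk => h3 (i, k) ?_⟩, fun i' hi' => ?_⟩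
      · exact fun e => hk (congrArg Prod.snd e)
      · exact (h i').inj (funext fun k => h3 (i', k) fun e => hi' (congrArg Prod.fst e))

/-! ### Order, admissibility and rank in a flag orthant. -/

namespace IsFlagOrthant

variable {G : OrientedGraph α} {R : J → J → Prop} {φ : α → J → ℤ}

theorem exists_of_support (h : G.IsFlagOrthant R φ) (u : α) (f : J → ℤ) (hf : ∀ j, 0 ≤ f j)
    (hs : ∀ j, f j ≠ 0 → φ u j ≠ 0) : ∃ w, φ w = f :=
  h.surj f hf fun j k hj hk => h.compat u j k (hs j hj) (hs k hk)

theorem le_imp (h : G.IsFlagOrthant R φ) {u v : α} (hle : G.le u v) (j : J) :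
    ZigzagLE (φ u j) (φ v j) := by
  induction hle with
  | refl => exact .refl _
  | tail _ hb ih =>
    refine ih.trans ?_
    obtain ⟨k, h1, h2, h3⟩ := (h.below_iff _ _).1 hb
    by_cases e : j = k
    · subst e; exact Or.inr ⟨h1, h2⟩
    · exact Or.inl (h3 j e)

theorem le_antisymm (h : G.IsFlagOrthant R φ) {u v : α} (h1 : G.le u v) (h2 : G.le v u) :
    u = v :=
  h.inj (funext fun j => (h.le_imp h1 j).antisymm (h.le_imp h2 j))

/-- Moving one coordinate of `u` to its value at a vector above `u`. -/
theorem exists_step (h : G.IsFlagOrthant R φ) {u v : α}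
    (hle : ∀ j, ZigzagLE (φ u j) (φ v j)) {j : J} (hj : φ u j ≠ φ v j) :
    ∃ w, G.below u w ∧ φ w j = φ v j ∧ ∀ k, k ≠ j → φ w k = φ u k := by
  classical
  obtain ⟨w, hw⟩ := h.exists_of_support v (Function.update (φ u) j (φ v j))
    (fun k => by
      by_cases e : k = j
      · subst e; simpa using h.nonneg v k
      · simpa [e] using h.nonneg u k)
    (fun k => by
      by_cases e : k = j
      · subst e; simp
      · simpa [e] using (hle k).ne_zero)
  refine ⟨w, (h.below_iff _ _).2 ⟨j, ?_⟩, by simp [hw], fun k hk => by simp [hw, hk]⟩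
  have := (hle j).resolve_left hj
  refine ⟨this.1, by simpa [hw] using this.2, fun k hk => by simp [hw, hk]⟩

theorem zigzagLE_step {u v w : α} {j : J} (hle : ∀ j, ZigzagLE (φ u j) (φ v j))
    (h1 : φ w j = φ v j) (h2 : ∀ k, k ≠ j → φ w k = φ u k) (k : J) :
    ZigzagLE (φ w k) (φ v k) := by
  by_cases e : k = j
  · subst e; rw [h1]; exact .refl _
  · rw [h2 k e]; exact hle k

theorem adj_natAbs (h : G.IsFlagOrthant R φ) {u v : α} (ha : G.graph.Adj u v) :
    ∃ j, (φ u j - φ v j).natAbs = 1 ∧ ∀ k, k ≠ j → φ u k = φ v k := by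
  rcases (G.adj_iff _ _).1 ha with hb | hb <;>
    obtain ⟨j, _, h2, h3⟩ := (h.below_iff _ _).1 hb
  · exact ⟨j, by omega, h3⟩
  · exact ⟨j, by omega, fun k hk => (h3 k hk).symm⟩

theorem adj_iff_natAbs (h : G.IsFlagOrthant R φ) {u v : α} : G.graph.Adj u v ↔
    ∃ j, (φ u j - φ v j).natAbs = 1 ∧ ∀ k, k ≠ j → φ u k = φ v k := by
  refine ⟨h.adj_natAbs, fun ⟨j, h1, h2⟩ => (G.adj_iff _ _).2 ?_⟩
  rw [h.below_iff, h.below_iff]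
  by_cases e : φ u j % 2 = 0
  · exact Or.inl ⟨j, e, by omega, h2⟩
  · exact Or.inr ⟨j, by omega, by omega, fun k hk => (h2 k hk).symm⟩

/-- A genuine 4-cycle moves two distinct coordinates, each on a pair of opposite edges. Every other
pattern of moved coordinates makes two opposite corners coincide. -/
theorem isAdmissible (h : G.IsFlagOrthant R φ) : G.IsAdmissible := by
  intro u₁ u₂ u₃ u₄ h12 h23 h34 h41 h13 h24 hb
  obtain ⟨i, a1, a2, a3⟩ := (h.below_iff _ _).1 hb
  obtain ⟨j, b1, b2⟩ := h.adj_natAbs h23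
  obtain ⟨k, c1, c2⟩ := h.adj_natAbs h34
  obtain ⟨l, d1, d2⟩ := h.adj_natAbs h41
  have n24 : ¬ ∀ x, φ u₂ x = φ u₄ x := fun H => h24 (h.inj (funext H))
  have n13 : ¬ ∀ x, φ u₁ x = φ u₃ x := fun H => h13 (h.inj (funext H))
  by_cases hkl : k = l
  · subst hkl
    have hij : j = i := by
      by_contra hij
      have e1 := b2 i (Ne.symm hij)
      have e2 := a3 j hij
      have ki : i = k := by
        by_contra e
        have := c2 i e
        have := d2 i e
        omega
      have kj : j = k := by
        by_contra e
        have := c2 j e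
        have := d2 j e
        omega
      exact hij (kj.trans ki.symm)
    subst hij
    -- All four edges now move the same coordinate, so `u₁` and `u₃` differ there by 2 and `u₂`,
    -- `u₄` are both their midpoint.
    have hd : φ u₁ j ≠ φ u₃ j := fun e => n13 fun x => by
      by_cases hx : x = j
      · exact hx ▸ e
      · exact (a3 x hx).symm.trans (b2 x hx)
    have kj : j = k := by
      by_contra e
      have := c2 j e
      have := d2 j e
      omega
    subst kj
    refine absurd (fun x => ?_) n24
    by_cases hx : x = j
    · subst hx; omega
    · exact (b2 x hx).trans (c2 x hx)
  · have ek := d2 k hkl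
    have el := c2 l (Ne.symm hkl)
    have hk : k = i ∨ k = j := by
      by_contra! e
      have := a3 k e.1
      have := b2 k e.2
      omega
    have hl : l = i ∨ l = j := by
      by_contra! e
      have := a3 l e.1
      have := b2 l e.2
      omega
    rcases hk with rfl | rfl <;> rcases hl with rfl | rfl
    · exact absurd rfl hkl
    · have e := b2 k hkl
      exact (h.below_iff _ _).2 ⟨k, by omega, by omega, c2⟩
    · refine absurd (fun x => ?_) n24
      by_cases hx : x = k
      · subst hx
        have := a3 x hkl
        omega
      · exact (b2 x hx).trans (c2 x hx)
    · exact absurd rfl hkl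

open Classical in
/-- The set of coordinates in which `u` and `v` differ. -/
noncomputable def diffSet [Fintype J] (φ : α → J → ℤ) (u v : α) : Finset J := {j | φ u j ≠ φ v j}

theorem mem_diffSet [Fintype J] {u v : α} {j : J} : j ∈ diffSet φ u v ↔ φ u j ≠ φ v j := by
  simp [diffSet]

variable [Fintype J]

theorem diffSet_eq_empty (h : G.IsFlagOrthant R φ) {u v : α} :
    diffSet φ u v = ∅ ↔ u = v := by
  constructor
  · intro he
    refine h.inj (funext fun j => ?_)
    by_contra hj
    have := mem_diffSet.2 hj
    simp [he] at this
  · rintro rfl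
    ext j
    simp [mem_diffSet]

theorem diffSet_step {u v w : α} {j : J} (hj : φ u j ≠ φ v j)
    (h1 : φ w j = φ v j) (h2 : ∀ k, k ≠ j → φ w k = φ u k) :
    (diffSet φ u v).card = (diffSet φ w v).card + 1 := by
  classical
  have : diffSet φ u v = insert j (diffSet φ w v) := by
    ext k
    rw [Finset.mem_insert, mem_diffSet, mem_diffSet]
    by_cases e : k = j
    · subst e; simp [hj]
    · simp [e, h2 k e]
  rw [this, Finset.card_insert_of_notMem (by simp [mem_diffSet, h1])]

theorem exists_ne_of_card {u v : α} {n : ℕ} (hn : (diffSet φ u v).card = n + 1) :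
    ∃ j, φ u j ≠ φ v j := by
  obtain ⟨j, hj⟩ := Finset.card_pos.1 (by omega : 0 < (diffSet φ u v).card)
  exact ⟨j, mem_diffSet.1 hj⟩

theorem le_iff (h : G.IsFlagOrthant R φ) {u v : α} :
    G.le u v ↔ ∀ j, ZigzagLE (φ u j) (φ v j) := by
  refine ⟨fun hle j => h.le_imp hle j, fun hle => ?_⟩
  generalize hn : (diffSet φ u v).card = n
  induction n generalizing u with
  | zero =>
    rw [h.diffSet_eq_empty.1 (Finset.card_eq_zero.1 hn)]
    exact Relation.ReflTransGen.refl
  | succ n ih =>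
    obtain ⟨j, hj⟩ := exists_ne_of_card hn
    obtain ⟨w, hb, h1, h2⟩ := h.exists_step hle hj
    refine Relation.ReflTransGen.head hb (ih (zigzagLE_step hle h1 h2) ?_)
    have := diffSet_step hj h1 h2
    omega

/-- The coordinates moved along `u ⪯ v` and `v ⪯ w` are disjoint, with union those of `u ⪯ w`. -/
theorem card_diffSet_add (h : G.IsFlagOrthant R φ) {u v w : α} (h1 : G.le u v) (h2 : G.le v w) :
    (diffSet φ u w).card = (diffSet φ u v).card + (diffSet φ v w).card := by
  classical
  rw [← Finset.card_union_of_disjoint]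
  · congr 1
    ext j
    have a1 := h.le_imp h1 j
    have a2 := h.le_imp h2 j
    rw [Finset.mem_union, mem_diffSet, mem_diffSet, mem_diffSet]
    unfold ZigzagLE at *
    omega
  · rw [Finset.disjoint_left]
    intro j hj hj'
    rw [mem_diffSet] at hj hj'
    have a1 := h.le_imp h1 j
    have a2 := h.le_imp h2 j
    unfold ZigzagLE at *
    omega

theorem exists_chain (h : G.IsFlagOrthant R φ) {u v : α} (hle : G.le u v) :
    ∃ c : Fin ((diffSet φ u v).card + 1) → α, c 0 = u ∧ c (Fin.last _) = v ∧
      ∀ i : Fin (diffSet φ u v).card, G.lt (c i.castSucc) (c i.succ) := by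
  generalize hn : (diffSet φ u v).card = n
  induction n generalizing u with
  | zero =>
    have := h.diffSet_eq_empty.1 (Finset.card_eq_zero.1 hn)
    exact ⟨fun _ => u, rfl, this, fun i => i.elim0⟩
  | succ n ih =>
    obtain ⟨j, hj⟩ := exists_ne_of_card hn
    obtain ⟨w, hb, h1, h2⟩ := h.exists_step (h.le_iff.1 hle) hj
    have := diffSet_step hj h1 h2
    obtain ⟨c, c0, cl, hc⟩ := ih (h.le_iff.2 (zigzagLE_step (h.le_iff.1 hle) h1 h2)) (by omega)
    refine ⟨Fin.cons u c, by simp, ?_, fun i => ?_⟩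
    · rw [← Fin.succ_last, Fin.cons_succ, cl]
    · refine Fin.cases ?_ (fun i => ?_) i
      · simp only [Fin.castSucc_zero, Fin.cons_zero, Fin.cons_succ, c0]
        refine ⟨Relation.ReflTransGen.single hb, ?_⟩
        rintro rfl
        exact hj h1
      · rw [← Fin.succ_castSucc, Fin.cons_succ, Fin.cons_succ]
        exact hc i

/-- Each strict step moves at least one coordinate, and no coordinate can be moved twice, since
after moving up it is odd. -/
theorem length_chain_le (h : G.IsFlagOrthant R φ) {l : ℕ} (c : Fin (l + 1) → α)
    (hc : ∀ i : Fin l, G.lt (c i.castSucc) (c i.succ)) (i : Fin (l + 1)) :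
    G.le (c 0) (c i) ∧ (i : ℕ) ≤ (diffSet φ (c 0) (c i)).card := by
  induction i using Fin.induction with
  | zero => exact ⟨Relation.ReflTransGen.refl, by simp⟩
  | succ i ih =>
    obtain ⟨h1, h2⟩ := ih
    obtain ⟨g1, g2⟩ := hc i
    refine ⟨h1.trans g1, ?_⟩
    rw [h.card_diffSet_add h1 g1]
    have : 0 < (diffSet φ (c i.castSucc) (c i.succ)).card :=
      Finset.card_pos.2 (Finset.nonempty_iff_ne_empty.2 fun e => g2 (h.diffSet_eq_empty.1 e))
    simp only [Fin.val_castSucc, Fin.val_succ] at *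
    omega

/-- The rank of an interval is the number of coordinates in which its ends differ. -/
theorem rank_eq (h : G.IsFlagOrthant R φ) {u v : α} (hle : G.le u v) :
    G.rank u v = (diffSet φ u v).card := by
  refine IsGreatest.csSup_eq ⟨h.exists_chain hle, ?_⟩
  rintro l ⟨c, rfl, rfl, hc⟩
  simpa using (h.length_chain_le c hc (Fin.last l)).2

/-! ### Median graph structure -/

/-- The `ℓ₁`-distance of the coordinate vectors. -/
def l1 (φ : α → J → ℤ) (u v : α) : ℕ := ∑ j, (φ u j - φ v j).natAbs

theorem l1_step {u v w : α} {j : J} (hj : (φ u j - φ v j).natAbs = (φ w j - φ v j).natAbs + 1)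
    (hk : ∀ k, k ≠ j → φ w k = φ u k) : l1 φ u v = l1 φ w v + 1 := by
  classical
  unfold l1
  rw [← Finset.add_sum_erase _ _ (Finset.mem_univ j),
    ← Finset.add_sum_erase _ (fun k => (φ w k - φ v k).natAbs) (Finset.mem_univ j), hj,
    Finset.sum_congr rfl fun k hk' => by rw [← hk k (Finset.ne_of_mem_erase hk')]]
  ring

theorem l1_le_length (h : G.IsFlagOrthant R φ) {u v : α} (p : G.graph.Walk u v) :
    l1 φ u v ≤ p.length := by
  classical
  induction p with
  | nil => simp [l1]
  | @cons u w v ha p ih =>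
    obtain ⟨j, h1, h2⟩ := h.adj_natAbs ha
    rw [SimpleGraph.Walk.length_cons]
    have : l1 φ u v ≤ l1 φ w v + 1 := by
      unfold l1
      rw [← Finset.add_sum_erase _ _ (Finset.mem_univ j),
        ← Finset.add_sum_erase _ (fun k => (φ w k - φ v k).natAbs) (Finset.mem_univ j),
        Finset.sum_congr rfl fun k hk' => by rw [h2 k (Finset.ne_of_mem_erase hk')]]
      omega
    omega

/-- A careless step towards `v` could create a clash of supports. Decreasing coordinates before
increasing any avoids this. -/
theorem exists_l1_step (h : G.IsFlagOrthant R φ) {u v : α} (hne : u ≠ v) :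
    ∃ w, G.graph.Adj u w ∧ l1 φ u v = l1 φ w v + 1 := by
  classical
  have key : ∃ (j : J) (x : ℤ), 0 ≤ x ∧ (φ u j - x).natAbs = 1 ∧
      (φ u j - φ v j).natAbs = (x - φ v j).natAbs + 1 ∧
      ∃ a, ∀ k, Function.update (φ u) j x k ≠ 0 → φ a k ≠ 0 := by
    by_cases hlt : ∃ j, φ v j < φ u j
    · obtain ⟨j, hj⟩ := hlt
      have := h.nonneg v j
      refine ⟨j, φ u j - 1, by omega, by omega, by omega, u, fun k => ?_⟩
      by_cases e : k = j
      · subst e; intro; omega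
      · simp [e]
    -- Now `u ≤ v` coordinatewise, so raising a coordinate towards `v` keeps the support inside that
    -- of `v`.
    · push Not at hlt
      obtain ⟨j, hj⟩ : ∃ j, φ u j ≠ φ v j := by
        by_contra hcon
        push Not at hcon
        exact hne (h.inj (funext hcon))
      have h1 := hlt j
      have h0 := h.nonneg u j
      refine ⟨j, φ u j + 1, by omega, by omega, by omega, v, fun k => ?_⟩
      have h2 := hlt k
      have h3 := h.nonneg u k
      by_cases e : k = j
      · subst e; intro; omega
      · simp only [Function.update_of_ne e]; omega
  obtain ⟨j, x, h0, h1, h2, a, ha⟩ := key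
  obtain ⟨w, hw⟩ := h.exists_of_support a (Function.update (φ u) j x)
    (fun k => by
      by_cases e : k = j
      · subst e; simpa using h0
      · simpa [e] using h.nonneg u k) ha
  exact ⟨w, h.adj_iff_natAbs.2 ⟨j, by simpa [hw] using h1, fun k hk => by simp [hw, hk]⟩,
    l1_step (j := j) (by simpa [hw] using h2) fun k hk => by simp [hw, hk]⟩

theorem exists_walk_length (h : G.IsFlagOrthant R φ) (u v : α) :
    ∃ p : G.graph.Walk u v, p.length = l1 φ u v := by
  generalize hn : l1 φ u v = n
  induction n generalizing u with
  | zero =>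
    have : u = v := by
      by_contra hne
      obtain ⟨w, _, hw⟩ := h.exists_l1_step hne
      omega
    subst this
    exact ⟨SimpleGraph.Walk.nil, rfl⟩
  | succ n ih =>
    have hne : u ≠ v := by
      rintro rfl
      simp [l1] at hn
    obtain ⟨w, ha, hw⟩ := h.exists_l1_step hne
    obtain ⟨p, hp⟩ := ih w (by omega)
    exact ⟨SimpleGraph.Walk.cons ha p, by simp [hp]⟩

theorem dist_eq_l1 (h : G.IsFlagOrthant R φ) (u v : α) : G.graph.dist u v = l1 φ u v := by
  obtain ⟨p, hp⟩ := h.exists_walk_length u v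
  refine Nat.le_antisymm (hp ▸ SimpleGraph.dist_le p) ?_
  obtain ⟨q, hq⟩ := SimpleGraph.Reachable.exists_walk_length_eq_dist ⟨p⟩
  exact hq ▸ h.l1_le_length q

theorem mem_metricInterval (h : G.IsFlagOrthant R φ) {u v w : α} :
    w ∈ G.metricInterval u v ↔ ∀ j, min (φ u j) (φ v j) ≤ φ w j ∧ φ w j ≤ max (φ u j) (φ v j) := by
  unfold metricInterval
  rw [Set.mem_ofPred_eq, h.dist_eq_l1, h.dist_eq_l1, h.dist_eq_l1]
  unfold l1
  rw [← Finset.sum_add_distrib, Finset.sum_eq_sum_iff_of_le fun j _ => by omega]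
  refine ⟨fun H j => ?_, fun H j _ => ?_⟩
  · have := H j (Finset.mem_univ j)
    omega
  · have := H j
    omega

theorem isMedian (h : G.IsFlagOrthant R φ) : G.IsMedian := by
  have hne : Nonempty α := by
    obtain ⟨u, _⟩ := h.surj 0 (by simp) (by simp)
    exact ⟨u⟩
  refine ⟨⟨fun u v => (h.exists_walk_length u v).elim fun p _ => ⟨p⟩⟩, fun u v w => ?_⟩
  obtain ⟨x, hx⟩ := h.surj
    (fun j => max (min (φ u j) (φ v j)) (min (max (φ u j) (φ v j)) (φ w j)))
    (fun j => by have := h.nonneg u j; have := h.nonneg v j; omega)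
    (fun j k hj hk => by
      have := h.nonneg u j; have := h.nonneg v j; have := h.nonneg w j
      have := h.nonneg u k; have := h.nonneg v k; have := h.nonneg w k
      -- A nonzero coordinate of the median is nonzero in at least two of `u`, `v`, `w`. Two such
      -- coordinates are therefore both nonzero in a common one of the three, which certifies their
      -- compatibility.
      by_cases hu : φ u j ≠ 0 ∧ φ u k ≠ 0
      · exact h.compat u j k hu.1 hu.2
      by_cases hv : φ v j ≠ 0 ∧ φ v k ≠ 0
      · exact h.compat v j k hv.1 hv.2
      exact h.compat w j k (by omega) (by omega))
  refine ⟨x, ⟨⟨?_, ?_⟩, ?_⟩, fun y hy => h.inj (funext fun j => ?_)⟩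
  · exact h.mem_metricInterval.2 fun j => by rw [hx]; simp only; omega
  · exact h.mem_metricInterval.2 fun j => by rw [hx]; simp only; omega
  · exact h.mem_metricInterval.2 fun j => by rw [hx]; simp only; omega
  · have h1 := h.mem_metricInterval.1 hy.1.1 j
    have h2 := h.mem_metricInterval.1 hy.1.2 j
    have h3 := h.mem_metricInterval.1 hy.2 j
    rw [hx]
    simp only
    omega

/-- The vector that agrees with `v` on `A`, and with `u ⪯ v` off `A`. -/
theorem exists_mix (h : G.IsFlagOrthant R φ) {u v : α} (hle : G.le u v) (A : Set J) :
    ∃ w, G.le u w ∧ G.le w v ∧ (∀ j ∈ A, φ w j = φ v j) ∧ ∀ j ∉ A, φ w j = φ u j := by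
  classical
  have H := h.le_iff.1 hle
  obtain ⟨w, hw⟩ := h.exists_of_support v (fun j => if j ∈ A then φ v j else φ u j)
    (fun j => by split_ifs <;> exact h.nonneg _ _)
    (fun j => by
      split_ifs
      · exact id
      · exact (H j).ne_zero)
  refine ⟨w, h.le_iff.2 fun j => ?_, h.le_iff.2 fun j => ?_, fun j hj => by simp [hw, hj],
    fun j hj => by simp [hw, hj]⟩
  · rw [hw]
    dsimp only
    split_ifs
    exacts [H j, .refl _]
  · rw [hw]
    dsimp only
    split_ifs
    exacts [.refl _, H j]

/-- On the interval every coordinate takes its value at `u` or at `v`, and by `exists_mix` all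
combinations occur. The structure is transported from the power set of the coordinates where `u` and
`v` differ. -/
theorem exists_booleanAlgebra (h : G.IsFlagOrthant R φ) {u v : α} (hle : G.le u v) :
    ∃ b : BooleanAlgebra {w : α // G.le u w ∧ G.le w v},
      ∀ x y : {w : α // G.le u w ∧ G.le w v}, b.le x y ↔ G.le x.1 y.1 := by
  choose g g1 g2 g3 g4 using h.exists_mix hle
  let D : Set J := {j | φ u j ≠ φ v j}
  have hend : ∀ (x : {w : α // G.le u w ∧ G.le w v}) (j : J), φ x.1 j = φ u j ∨ φ x.1 j = φ v j := by
    intro x j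
    have a1 := h.le_imp x.2.1 j
    have a2 := h.le_imp x.2.2 j
    unfold ZigzagLE at *
    omega
  let e : {w : α // G.le u w ∧ G.le w v} ≃ Set D :=
    { toFun := fun x => {j | φ x.1 j = φ v j}
      invFun := fun A => ⟨g (Subtype.val '' A), g1 _, g2 _⟩
      left_inv := fun x => by
        refine Subtype.ext (h.inj (funext fun j => ?_))
        by_cases hj : j ∈ Subtype.val '' {j : D | φ x.1 j = φ v j}
        · refine (g3 _ j hj).trans ?_
          obtain ⟨k, hk, rfl⟩ := hj
          exact hk.symm
        · refine (g4 _ j hj).trans ?_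
          rcases hend x j with h1 | h1
          · exact h1.symm
          · by_cases hD : φ u j = φ v j
            · rw [h1, hD]
            · exact absurd ⟨⟨j, hD⟩, h1, rfl⟩ hj
      right_inv := fun A => by
        ext ⟨j, hj⟩
        by_cases hA : (⟨j, hj⟩ : D) ∈ A
        · exact iff_of_true (g3 _ j ⟨_, hA, rfl⟩) hA
        · refine iff_of_false (fun H => hj ?_) hA
          have : j ∉ Subtype.val '' A := by
            rintro ⟨k, hk, rfl⟩
            exact hA hk
          exact (g4 _ j this).symm.trans H }
  refine ⟨e.booleanAlgebra, fun x y => ?_⟩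
  change (∀ j : D, φ x.1 j = φ v j → φ y.1 j = φ v j) ↔ _
  rw [h.le_iff]
  constructor
  · intro H j
    by_cases hD : φ u j = φ v j
    · have h1 := hend x j
      have h2 := hend y j
      exact Or.inl (by omega)
    · have h1 := hend x j
      have h2 := hend y j
      have h3 : φ x.1 j = φ v j → φ y.1 j = φ v j := H ⟨j, hD⟩
      have h4 := h.le_imp hle j
      unfold ZigzagLE at *
      omega
  · rintro H ⟨j, hj⟩ hx
    have h1 := hend y j
    have h3 := H j
    have h4 := h.le_imp hle j
    change φ y.1 j = φ v j
    change φ x.1 j = φ v j at hx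
    change φ u j ≠ φ v j at hj
    unfold ZigzagLE at *
    omega

theorem isWellOrientedMedian (h : G.IsFlagOrthant R φ) : G.IsWellOrientedMedian :=
  ⟨h.isMedian, h.isAdmissible, fun _ _ hle => h.exists_booleanAlgebra hle⟩

end IsFlagOrthant
end OrientedGraph

/-! ### L-convexity in coordinates -/

/-- The positions of one coordinate at `u`, `v`, `u ∧ v`, `u ∨ v`. -/
def SquarePos (a b m j : ℤ) : Prop := (a = m ∧ b = j ∨ a = j ∧ b = m) ∧ ZigzagLE m j

theorem SquarePos.neg {a b m j : ℤ} (h : SquarePos a b m j) : SquarePos (-a) (-b) (-m) (-j) := by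
  unfold SquarePos ZigzagLE at *; omega

/-- A convex function of a sum of two coordinates, linear apart from one even kink, is
submodular. -/
theorem SquarePos.kink_le {a b m j a' b' m' j' : ℤ} (h : SquarePos a b m j)
    (h' : SquarePos a' b' m' j') (c : ℤ) :
    max (m + m' + 2 * c) 0 + max (j + j' + 2 * c) 0 ≤
      max (a + a' + 2 * c) 0 + max (b + b' + 2 * c) 0 := by
  obtain ⟨h1, h2⟩ := h
  obtain ⟨h1', h2'⟩ := h'
  unfold ZigzagLE at *
  -- Parallel positions give equality. In crossed positions put `e = m + m' + 2c`, which is even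
  -- when both coordinates move. Opposite moves give convexity around `e`. Equal moves compare the
  -- midpoint of two consecutive even numbers with these two numbers, and there is no kink between
  -- them.
  rcases h1 with ⟨rfl, rfl⟩ | ⟨rfl, rfl⟩ <;> rcases h1' with ⟨rfl, rfl⟩ | ⟨rfl, rfl⟩ <;> omega

namespace OrientedGraph

variable {α J : Type*} {G : OrientedGraph α} {R : J → J → Prop} {φ : α → J → ℤ}

theorem IsJoinAntipodal.symm {u v j : α} (h : G.IsJoinAntipodal u v j) :
    G.IsJoinAntipodal v u j := by
  obtain ⟨h1, h2, ⟨h3, h4, h5⟩, h6⟩ := h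
  refine ⟨h2, h1, ⟨h4, h3, fun w a b => h5 w b a⟩, fun a b ha ha' hb hb' ⟨w, hw, hw'⟩ => ?_⟩
  have := h6 b a hb' hb ha' ha ⟨w, hw', hw⟩
  rw [mul_comm, mul_comm (G.rank a j)]
  exact this

/-- The defining inequalities of L-convexity, with the configurations of the nodes described in
coordinates. -/
structure CoordLConvex (G : OrientedGraph α) (φ : α → J → ℤ) (f : α → ℝ) : Prop where
  square : ∀ u v m j, (∀ k, SquarePos (φ u k) (φ v k) (φ m k) (φ j k)) → f m + f j ≤ f u + f v
  meet : ∀ u v m, G.IsMeetAntipodal u v m →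
    ((G.rank m u : ℝ) + G.rank m v) * f m ≤ G.rank m v * f u + G.rank m u * f v
  join : ∀ u v j, (∀ k, φ u k + φ v k = 2 * φ j k) → (∀ k, ZigzagLE (φ u k) (φ j k)) →
    (∀ k, ZigzagLE (φ v k) (φ j k)) → 2 * f j ≤ f u + f v

namespace CoordLConvex

variable {f g : α → ℝ}

theorem zero : CoordLConvex G φ fun _ => 0 :=
  ⟨fun _ _ _ _ _ => by simp, fun _ _ _ _ => by simp, fun _ _ _ _ _ _ => by simp⟩

theorem add (hf : CoordLConvex G φ f) (hg : CoordLConvex G φ g) :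
    CoordLConvex G φ fun p => f p + g p := by
  refine ⟨fun u v m j h => ?_, fun u v m h => ?_, fun u v j h h' h'' => ?_⟩
  · linarith [hf.square u v m j h, hg.square u v m j h]
  · linarith [hf.meet u v m h, hg.meet u v m h]
  · linarith [hf.join u v j h h' h'', hg.join u v j h h' h'']

theorem const_mul (hf : CoordLConvex G φ f) {c : ℝ} (hc : 0 ≤ c) :
    CoordLConvex G φ fun p => c * f p := by
  refine ⟨fun u v m j h => ?_, fun u v m h => ?_, fun u v j h h' h'' => ?_⟩
  · linarith [mul_le_mul_of_nonneg_left (hf.square u v m j h) hc]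
  · linarith [mul_le_mul_of_nonneg_left (hf.meet u v m h) hc]
  · linarith [mul_le_mul_of_nonneg_left (hf.join u v j h h' h'') hc]

theorem sum {I : Type*} {s : Finset I} {F : I → α → ℝ} (hF : ∀ i ∈ s, CoordLConvex G φ (F i)) :
    CoordLConvex G φ fun p => ∑ i ∈ s, F i p := by
  classical
  induction s using Finset.induction_on with
  | empty => simpa using zero
  | insert a s ha ih =>
    simp only [Finset.sum_insert ha]
    exact (hF a (Finset.mem_insert_self _ _)).add
      (ih fun i hi => hF i (Finset.mem_insert_of_mem hi))

end CoordLConvex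

/-! ### Meets, joins and `∨`-antipodal pairs in coordinates. -/

namespace IsFlagOrthant

variable [Fintype J]

theorem exists_meet_join (h : G.IsFlagOrthant R φ) {u v : α} (hU : G.UpperBounded u v)
    (hL : G.LowerBounded u v) : ∃ m j, G.IsMeet u v m ∧ G.IsJoin u v j ∧
      ∀ k, SquarePos (φ u k) (φ v k) (φ m k) (φ j k) := by
  obtain ⟨t, htu, htv⟩ := hU
  obtain ⟨b, hbu, hbv⟩ := hL
  have key : ∀ k, ZigzagLE (φ u k) (φ t k) ∧ ZigzagLE (φ v k) (φ t k) ∧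
      ZigzagLE (φ b k) (φ u k) ∧ ZigzagLE (φ b k) (φ v k) :=
    fun k => ⟨h.le_imp htu k, h.le_imp htv k, h.le_imp hbu k, h.le_imp hbv k⟩
  -- Having both bounds forces distinct `φ u k`, `φ v k` to be neighbours of opposite parity. The
  -- even one is the meet and the odd one the join.
  obtain ⟨m, hm⟩ := h.exists_of_support u (fun k => if φ u k % 2 = 0 then φ u k else φ v k)
    (fun k => by split_ifs <;> exact h.nonneg _ _)
    (fun k => by split_ifs <;> omega)
  obtain ⟨j, hj⟩ := h.exists_of_support t (fun k => if φ u k % 2 = 0 then φ v k else φ u k)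
    (fun k => by split_ifs <;> exact h.nonneg _ _)
    (fun k => by
      split_ifs
      exacts [(key k).2.1.ne_zero, (key k).1.ne_zero])
  have hs : ∀ k, SquarePos (φ u k) (φ v k) (φ m k) (φ j k) := fun k => by
    have := key k
    rw [hm, hj]
    unfold SquarePos ZigzagLE at *
    dsimp only
    split_ifs <;> omega
  have cmp : ∀ k, ZigzagLE (φ m k) (φ u k) ∧ ZigzagLE (φ m k) (φ v k) ∧
      ZigzagLE (φ u k) (φ j k) ∧ ZigzagLE (φ v k) (φ j k) := fun k => by
    have := hs k
    unfold SquarePos ZigzagLE at *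
    omega
  refine ⟨m, j, ⟨h.le_iff.2 fun k => (cmp k).1, h.le_iff.2 fun k => (cmp k).2.1, fun w h1 h2 =>
    h.le_iff.2 fun k => ?_⟩, ⟨h.le_iff.2 fun k => (cmp k).2.2.1, h.le_iff.2 fun k => (cmp k).2.2.2,
    fun w h1 h2 => h.le_iff.2 fun k => ?_⟩, hs⟩
  · rcases (hs k).1 with h3 | h3
    exacts [h3.1 ▸ h.le_imp h1 k, h3.2 ▸ h.le_imp h2 k]
  · rcases (hs k).1 with h3 | h3
    exacts [h3.2 ▸ h.le_imp h2 k, h3.1 ▸ h.le_imp h1 k]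

/-- Below `j` there are no clashes of supports, so the antipodality inequality may be tested with
`u` itself and a node `b` that is raised to `j` exactly where `u` differs from `j`. The left side is
then zero, which forces `b = j`. -/
theorem eq_of_isJoinAntipodal (h : G.IsFlagOrthant R φ) {u v j : α} (hj : G.IsJoinAntipodal u v j)
    {k : J} (hk : φ u k = φ j k) : φ v k = φ j k := by
  classical
  obtain ⟨h1, h2, ⟨h3, h4, h5⟩, h6⟩ := hj
  obtain ⟨b, b1, b2, b3, b4⟩ := h.exists_mix h4 {k | φ u k ≠ φ j k}
  have hlow : G.LowerBounded u b := by
    obtain ⟨w, hw⟩ := h.exists_of_support j (fun k => if φ u k ≠ φ j k then φ u k else φ v k)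
      (fun k => by split_ifs <;> exact h.nonneg _ _)
      (fun k => by
        split_ifs
        exacts [(h.le_imp h3 k).ne_zero, (h.le_imp h4 k).ne_zero])
    refine ⟨w, h.le_iff.2 fun k => ?_, h.le_iff.2 fun k => ?_⟩ <;> rw [hw] <;> dsimp only <;>
      split_ifs with hk
    · exact .refl _
    · rw [not_not.1 hk]; exact h.le_imp h4 k
    · rw [b3 k hk]; exact h.le_imp h3 k
    · rw [b4 k hk]; exact .refl _
  have := h6 u b Relation.ReflTransGen.refl h3 b2 b1 hlow
  rw [h.rank_eq (u := u) (v := u) Relation.ReflTransGen.refl, h.diffSet_eq_empty.2 rfl,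
    Finset.card_empty, zero_mul, ge_iff_le, Nat.le_zero, mul_eq_zero, h.rank_eq h3, h.rank_eq b2,
    Finset.card_eq_zero, Finset.card_eq_zero, h.diffSet_eq_empty, h.diffSet_eq_empty] at this
  rcases this with rfl | rfl
  · exact absurd h4 h2
  · exact (b4 k fun h => h hk).symm

theorem add_eq_of_isJoinAntipodal (h : G.IsFlagOrthant R φ) {u v j : α}
    (hj : G.IsJoinAntipodal u v j) (k : J) : φ u k + φ v k = 2 * φ j k := by
  have e1 := h.eq_of_isJoinAntipodal hj (k := k)
  have e2 := h.eq_of_isJoinAntipodal hj.symm (k := k)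
  obtain ⟨h1, h2, ⟨h3, h4, h5⟩, h6⟩ := hj
  have a1 := h.le_imp h3 k
  have a2 := h.le_imp h4 k
  obtain ⟨w, w1, w2, w3, w4⟩ := h.exists_mix h3 {k}ᶜ
  -- If `u` and `v` agree at `k` but lie strictly below `j` there, then lowering `j` at `k` gives a
  -- smaller upper bound.
  have a3 : φ u k = φ v k → φ u k = φ j k := by
    intro e
    have : G.le v w := h.le_iff.2 fun i => by
      by_cases hi : i = k
      · subst hi
        rw [w4 i (by simp), e]
        exact .refl _
      · rw [w3 i (by simpa using hi)]
        exact h.le_imp h4 i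
    have := h.le_imp (h5 w w1 this) k
    rw [w4 k (by simp)] at this
    exact a1.antisymm this
  unfold ZigzagLE at *
  omega

theorem rank_eq_of_isJoinAntipodal (h : G.IsFlagOrthant R φ) {u v j : α}
    (hj : G.IsJoinAntipodal u v j) : G.rank u j = G.rank v j := by
  rw [h.rank_eq hj.2.2.1.1, h.rank_eq hj.2.2.1.2.1]
  congr 1
  ext k
  rw [mem_diffSet, mem_diffSet]
  have := h.add_eq_of_isJoinAntipodal hj k
  omega

theorem lConvex (h : G.IsFlagOrthant R φ) {f : α → ℝ} (hf : CoordLConvex G φ f) :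
    G.LConvex f := by
  refine ⟨fun u v hU hL => ?_, hf.meet, fun u v j hj => ?_⟩
  · obtain ⟨m, j, hm, hj, hs⟩ := h.exists_meet_join hU hL
    exact ⟨m, j, hm, hj, hf.square u v m j hs⟩
  -- The two ranks agree, so the weighted inequality is a multiple of midpoint convexity.
  · have := hf.join u v j (h.add_eq_of_isJoinAntipodal hj) (h.le_imp hj.2.2.1.1)
      (h.le_imp hj.2.2.1.2.1)
    rw [h.rank_eq_of_isJoinAntipodal hj]
    have h0 : (0 : ℝ) ≤ G.rank v j := Nat.cast_nonneg _
    nlinarith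

/-! ### Linear functions on meet-antipodal pairs -/

/-- Raising `m` to `u` on `P` and to `v` on `Q` gives `a` and `b` with a common upper bound, because
`P` and `Q` are mutually compatible. The claim is the antipodality inequality for this pair. -/
theorem card_le_of_isMeetAntipodal (h : G.IsFlagOrthant R φ) {u v m : α}
    (hm : G.IsMeetAntipodal u v m) (P Q : Finset J) (hP : P ⊆ diffSet φ m u)
    (hQ : Q ⊆ diffSet φ m v) (hPQ : ∀ j ∈ P, ∀ k ∈ Q, j ≠ k ∧ R j k) :
    P.card * (diffSet φ m v).card + Q.card * (diffSet φ m u).card ≤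
      (diffSet φ m u).card * (diffSet φ m v).card := by
  classical
  obtain ⟨_, _, ⟨h3, h4, _⟩, h6⟩ := hm
  obtain ⟨a, a1, a2, a3, a4⟩ := h.exists_mix h3 P
  obtain ⟨b, b1, b2, b3, b4⟩ := h.exists_mix h4 Q
  have hup : G.UpperBounded a b := by
    have hcases : ∀ k, (k ∈ P ∧ k ∉ Q) ∨ (k ∉ P ∧ k ∈ Q) ∨ (k ∉ P ∧ k ∉ Q) := by
      intro k
      have := fun h1 h2 => (hPQ k h1 k h2).1 rfl
      tauto
    obtain ⟨w, hw⟩ := h.surj (fun k => if k ∈ P then φ u k else if k ∈ Q then φ v k else φ m k)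
      (fun k => by split_ifs <;> exact h.nonneg _ _)
      (fun j k hj hk => by
        -- An index outside `P ∪ Q` keeps its value at `m`, so it counts as supported in `u` and in
        -- `v`. Only a pair in `P × Q` needs the hypothesis on `P` and `Q`.
        have hu : ∀ k, k ∉ Q →
            (if k ∈ P then φ u k else if k ∈ Q then φ v k else φ m k) ≠ 0 → φ u k ≠ 0 := by
          intro k hk
          split_ifs
          exacts [id, (h.le_imp h3 k).ne_zero]
        have hv : ∀ k, k ∉ P →
            (if k ∈ P then φ u k else if k ∈ Q then φ v k else φ m k) ≠ 0 → φ v k ≠ 0 := by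
          intro k hk
          split_ifs
          exacts [id, (h.le_imp h4 k).ne_zero]
        rcases hcases j with ⟨j1, j2⟩ | ⟨j1, j2⟩ | ⟨j1, j2⟩ <;>
          rcases hcases k with ⟨k1, k2⟩ | ⟨k1, k2⟩ | ⟨k1, k2⟩
        · exact h.compat u _ _ (hu j j2 hj) (hu k k2 hk)
        · exact (hPQ j j1 k k2).2
        · exact h.compat u _ _ (hu j j2 hj) (hu k k2 hk)
        · exact h.symm _ _ (hPQ k k1 j j2).2
        · exact h.compat v _ _ (hv j j1 hj) (hv k k1 hk)
        · exact h.compat v _ _ (hv j j1 hj) (hv k k1 hk)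
        · exact h.compat u _ _ (hu j j2 hj) (hu k k2 hk)
        · exact h.compat v _ _ (hv j j1 hj) (hv k k1 hk)
        · exact h.compat u _ _ (hu j j2 hj) (hu k k2 hk))
    refine ⟨w, h.le_iff.2 fun k => ?_, h.le_iff.2 fun k => ?_⟩ <;> rw [hw] <;> dsimp only <;>
      rcases hcases k with ⟨k1, k2⟩ | ⟨k1, k2⟩ | ⟨k1, k2⟩
    · rw [if_pos k1, a3 k k1]; exact .refl _
    · rw [if_neg k1, if_pos k2, a4 k k1]; exact h.le_imp h4 k
    · rw [if_neg k1, if_neg k2, a4 k k1]; exact .refl _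
    · rw [if_pos k1, b4 k k2]; exact h.le_imp h3 k
    · rw [if_neg k1, if_pos k2, b3 k k2]; exact .refl _
    · rw [if_neg k1, if_neg k2, b4 k k2]; exact .refl _
  have H := h6 a b a2 a1 b1 b2 hup
  rw [h.rank_eq a1, h.rank_eq a2, h.rank_eq b1, h.rank_eq b2] at H
  have e1 := h.card_diffSet_add a1 a2
  have e2 := h.card_diffSet_add b1 b2
  have eP : diffSet φ m a = P := by
    ext k
    rw [mem_diffSet]
    by_cases hk : k ∈ P
    · simpa [a3 k hk, hk] using mem_diffSet.1 (hP hk)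
    · simp [a4 k hk, hk]
  have eQ : diffSet φ m b = Q := by
    ext k
    rw [mem_diffSet]
    by_cases hk : k ∈ Q
    · simpa [b3 k hk, hk] using mem_diffSet.1 (hQ hk)
    · simp [b4 k hk, hk]
  rw [eP] at e1 H
  rw [eQ] at e2 H
  rw [e1, e2]
  -- With `x`, `y` the numbers of differing coordinates, `H` reads `(x - |P|)(y - |Q|) ≥ |P||Q|`,
  -- and the products `|P||Q|` cancel.
  nlinarith

/-- A sum of signs counts the positive ones minus the negative ones. -/
theorem sum_sign_eq (δ : J → ℤ) (hδ : ∀ k, δ k = -1 ∨ δ k = 0 ∨ δ k = 1) :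
    ∑ k, δ k = (Finset.univ.filter fun k => δ k = 1).card -
      ((Finset.univ.filter fun k => δ k = -1).card : ℤ) := by
  rw [Finset.card_filter, Finset.card_filter]
  push_cast
  rw [← Finset.sum_sub_distrib]
  refine Finset.sum_congr rfl fun k _ => ?_
  rcases hδ k with e | e | e <;> simp [e]

/-- The linear function of the coordinates with coefficients `l`. -/
def lin (φ : α → J → ℤ) (l : J → ℤ) (u : α) : ℤ := ∑ k, l k * φ u k

/-- Let `δ` be the change, `-1`, `0` or `1`, that a coordinate contributes on the way up from `m`.
If the contributions of an index from `u` and one from `v` have negative sum, the two indices are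
compatible. So the previous bound applies to the negative indices of one side against the
nonpositive ones of the other, and the two bounds obtained add up to the claim. -/
theorem lin_of_isMeetAntipodal (h : G.IsFlagOrthant R φ) {l : J → ℤ}
    (hl : ∀ k, l k = -1 ∨ l k = 0 ∨ l k = 1)
    (hR : ∀ j k, R j j → R k k → ¬ R j k → 0 ≤ l j + l k)
    {u v m : α} (hm : G.IsMeetAntipodal u v m) :
    ((G.rank m u : ℤ) + G.rank m v) * lin φ l m ≤
      G.rank m v * lin φ l u + G.rank m u * lin φ l v := by
  classical
  have h3 := hm.2.2.1.1
  have h4 := hm.2.2.1.2.1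
  have h5 := hm.2.2.1.2.2
  rw [h.rank_eq h3, h.rank_eq h4]
  -- Where `u` and `v` agree, `m` could be raised to the common value and remain a lower bound.
  have hmeet : ∀ k, φ u k = φ v k → φ m k = φ u k := by
    intro k e
    obtain ⟨w, w1, w2, w3, w4⟩ := h.exists_mix h3 {k}
    have : G.le w v := h.le_iff.2 fun i => by
      by_cases hi : i = k
      · subst hi
        rw [w3 i rfl, e]
        exact .refl _
      · rw [w4 i hi]
        exact h.le_imp h4 i
    have := h.le_imp (h5 w w2 this) k
    rw [w3 k rfl] at this
    exact (h.le_imp h3 k).antisymm this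
  let δ : α → J → ℤ := fun x k => l k * (φ x k - φ m k)
  have hlin : ∀ x, lin φ l x = lin φ l m + ∑ k, δ x k := by
    intro x
    simp only [lin, δ]
    rw [← Finset.sum_add_distrib]
    exact Finset.sum_congr rfl fun k _ => by ring
  have hδ : ∀ x, G.le m x → ∀ k, δ x k = -1 ∨ δ x k = 0 ∨ δ x k = 1 := by
    intro x hx k
    have := h.le_imp hx k
    simp only [δ]
    rcases this with e | ⟨_, e | e⟩ <;> rcases hl k with e' | e' | e' <;> rw [e, e'] <;> simp
  have hmem : ∀ x k, δ x k ≠ 0 → k ∈ diffSet φ m x := by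
    intro x k hk
    rw [mem_diffSet]
    intro e
    simp [δ, e] at hk
  have conflict : ∀ j ∈ diffSet φ m u, ∀ k ∈ diffSet φ m v, δ u j + δ v k < 0 → j ≠ k ∧ R j k := by
    intro j hj k hk hneg
    rw [mem_diffSet] at hj hk
    have a1 := (h.le_imp h3 j).resolve_left hj
    have a2 := (h.le_imp h4 k).resolve_left hk
    have jk : j ≠ k := by
      rintro rfl
      have := hmeet j
      have e : φ v j - φ m j = -(φ u j - φ m j) := by omega
      simp only [δ, e] at hneg
      linarith
    refine ⟨jk, ?_⟩
    by_contra hr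
    have uj : φ u j ≠ 0 := by omega
    have vk : φ v k ≠ 0 := by omega
    -- Were `m` nonzero at `k`, so would `u` be, and `u` would witness the compatibility of `j` and
    -- `k`. Hence clashing indices both start from zero and move to 1, and their contributions are
    -- the coefficients themselves.
    have mk : φ m k = 0 := by
      by_contra e
      exact hr (h.compat u _ _ uj ((h.le_imp h3 k).ne_zero e))
    have mj : φ m j = 0 := by
      by_contra e
      exact hr (h.compat v _ _ ((h.le_imp h4 j).ne_zero e) vk)
    have e1 : φ u j = 1 := by have := h.nonneg u j; omega
    have e2 : φ v k = 1 := by have := h.nonneg v k; omega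
    have := hR j k (h.compat u _ _ uj uj) (h.compat v _ _ vk vk) hr
    simp only [δ, e1, e2, mj, mk] at hneg
    linarith
  set Du := diffSet φ m u
  set Dv := diffSet φ m v
  let pos : α → Finset J := fun x => Finset.univ.filter fun k => δ x k = 1
  let neg : α → Finset J := fun x => Finset.univ.filter fun k => δ x k = -1
  have hpos : ∀ x, pos x ⊆ diffSet φ m x := fun x k hk =>
    hmem x k (by rw [(Finset.mem_filter.1 hk).2]; decide)
  have hneg : ∀ x, neg x ⊆ diffSet φ m x := fun x k hk =>
    hmem x k (by rw [(Finset.mem_filter.1 hk).2]; decide)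
  have k1 := h.card_le_of_isMeetAntipodal hm (neg u) (Dv \ pos v) (hneg u)
    Finset.sdiff_subset fun j hj k hk => by
      rw [Finset.mem_sdiff] at hk
      refine conflict j (hneg u hj) k hk.1 ?_
      have e1 : δ u j = -1 := (Finset.mem_filter.1 hj).2
      have e2 : δ v k ≠ 1 := fun e => hk.2 (Finset.mem_filter.2 ⟨Finset.mem_univ _, e⟩)
      have := hδ v h4 k
      omega
  have k2 := h.card_le_of_isMeetAntipodal hm (Du \ pos u) (neg v) Finset.sdiff_subset (hneg v)
    fun j hj k hk => by
      rw [Finset.mem_sdiff] at hj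
      refine conflict j hj.1 k (hneg v hk) ?_
      have e1 : δ v k = -1 := (Finset.mem_filter.1 hk).2
      have e2 : δ u j ≠ 1 := fun e => hj.2 (Finset.mem_filter.2 ⟨Finset.mem_univ _, e⟩)
      have := hδ u h3 j
      omega
  have c1 := Finset.card_sdiff_add_card_eq_card (hpos v)
  have c2 := Finset.card_sdiff_add_card_eq_card (hpos u)
  have s1 := sum_sign_eq (δ u) (hδ u h3)
  have s2 := sum_sign_eq (δ v) (hδ v h4)
  rw [hlin u, hlin v, s1, s2]
  change _ ≤ _ * (_ + (((pos u).card : ℤ) - (neg u).card)) +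
    _ * (_ + (((pos v).card : ℤ) - (neg v).card))
  zify at k1 k2 c1 c2
  rw [← eq_sub_iff_add_eq] at c1 c2
  rw [c1] at k1
  rw [c2] at k2
  linarith

theorem kink_of_isMeetAntipodal (h : G.IsFlagOrthant R φ) {l : J → ℤ}
    (hl : ∀ k, l k = -1 ∨ l k = 0 ∨ l k = 1)
    (hR : ∀ j k, R j j → R k k → ¬ R j k → 0 ≤ l j + l k) (c : ℤ)
    {u v m : α} (hm : G.IsMeetAntipodal u v m) :
    ((G.rank m u : ℤ) + G.rank m v) * max (lin φ l m + c) 0 ≤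
      G.rank m v * max (lin φ l u + c) 0 + G.rank m u * max (lin φ l v + c) 0 := by
  have H := h.lin_of_isMeetAntipodal hl hR hm
  have h1 : (0 : ℤ) ≤ G.rank m u := Nat.cast_nonneg _
  have h2 : (0 : ℤ) ≤ G.rank m v := Nat.cast_nonneg _
  have a1 := mul_le_mul_of_nonneg_left (le_max_left (lin φ l u + c) 0) h2
  have a2 := mul_le_mul_of_nonneg_left (le_max_left (lin φ l v + c) 0) h1
  have b1 := mul_le_mul_of_nonneg_left (le_max_right (lin φ l u + c) 0) h2
  have b2 := mul_le_mul_of_nonneg_left (le_max_right (lin φ l v + c) 0) h1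
  -- Where the positive part is active at `m` the linear inequality applies; otherwise the left side
  -- is zero.
  rcases max_cases (lin φ l m + c) 0 with ⟨e, _⟩ | ⟨e, _⟩ <;> rw [e] <;> linarith

theorem lin_midpoint (l : J → ℤ) {u v j : α} (h : ∀ k, φ u k + φ v k = 2 * φ j k) :
    lin φ l u + lin φ l v = 2 * lin φ l j := by
  unfold lin
  rw [Finset.mul_sum, ← Finset.sum_add_distrib]
  refine Finset.sum_congr rfl fun k _ => ?_
  linear_combination l k * h k

theorem kink_midpoint (l : J → ℤ) (c : ℤ) {u v j : α} (h : ∀ k, φ u k + φ v k = 2 * φ j k) :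
    2 * max (lin φ l j + c) 0 ≤ max (lin φ l u + c) 0 + max (lin φ l v + c) 0 := by
  have := lin_midpoint l h
  omega

end IsFlagOrthant
end OrientedGraph

/-! ## Coordinates on the extended subtree space -/

namespace SubtreeSpace

variable {ι : Type*}

open Classical in
/-- The coordinate `-T_t`, for any `t ≠ s`, of a member of `𝕎_s`, and `0` off `𝕎_s`. -/
noncomputable def depth (T : ι → ℤ) (s : ι) : ℤ :=
  if h : ∃ t, t ≠ s ∧ T ∈ W s then -T h.choose else 0

/-- The grid coordinates of an element of the extended subtree space. -/
noncomputable def coord (T : ι → ℤ) : ι ⊕ ι → ℤ := Sum.elim (fun s => max (T s) 0) (depth T)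

/-- The index that a grid coordinate belongs to. -/
def leg : ι ⊕ ι → ι := Sum.elim id id

/-- The pairs of grid coordinates that can be nonzero simultaneously. -/
def Compatible (σ τ : ι ⊕ ι) : Prop := (σ.isLeft ∧ τ.isLeft) ∨ leg σ = leg τ

@[simp] theorem coord_inl (T : ι → ℤ) (s : ι) : coord T (Sum.inl s) = max (T s) 0 := rfl

@[simp] theorem coord_inr (T : ι → ℤ) (s : ι) : coord T (Sum.inr s) = depth T s := rfl

@[simp] theorem leg_inl (s : ι) : leg (Sum.inl s) = s := rfl

@[simp] theorem leg_inr (s : ι) : leg (Sum.inr s) = s := rfl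

variable {T T' : ι → ℤ} {s t : ι}

theorem depth_of_mem_W (hT : T ∈ W s) (hts : t ≠ s) : depth T s = -T t := by
  have hex : ∃ t, t ≠ s ∧ T ∈ W s := ⟨t, hts, hT⟩
  unfold depth
  rw [dif_pos hex, (hT.2 _ t hex.choose_spec.1 hts).1]

theorem depth_of_mem_C (hT : T ∈ C ι) (s : ι) : depth T s = 0 := by
  unfold depth
  split_ifs with hex
  · obtain ⟨h1, h2⟩ := hex.choose_spec
    have := (h2.2 _ _ h1 h1).2
    have := hT hex.choose
    omega
  · rfl

theorem mem_W_of_depth_ne_zero (h : depth T s ≠ 0) : T ∈ W s := by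
  unfold depth at h
  split_ifs at h with hex
  · exact hex.choose_spec.2
  · exact absurd rfl h

theorem depth_of_mem_W_of_ne (hT : T ∈ W s) (hts : t ≠ s) : depth T t = 0 := by
  by_contra h
  have hC := mem_C_of_mem_W_of_mem_W hts (mem_W_of_depth_ne_zero h) hT
  exact h (depth_of_mem_C hC t)

theorem depth_nonneg (T : ι → ℤ) (s : ι) : 0 ≤ depth T s := by
  unfold depth
  split_ifs with hex
  · obtain ⟨h1, h2⟩ := hex.choose_spec
    have := (h2.2 _ _ h1 h1).2
    omega
  · rfl

theorem coord_nonneg (T : ι → ℤ) (σ : ι ⊕ ι) : 0 ≤ coord T σ := by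
  rcases σ with s | s
  · exact le_max_right _ _
  · exact depth_nonneg T s

theorem coord_of_mem_W (hT : T ∈ W s) {σ : ι ⊕ ι} (hσ : leg σ ≠ s) : coord T σ = 0 := by
  rcases σ with t | t
  · exact max_eq_right (hT.2 t t hσ hσ).2
  · exact depth_of_mem_W_of_ne hT hσ

section Nontrivial

variable [Nontrivial ι]

theorem mem_C_or_depth_ne_zero (hT : T ∈ Sbar ι) : T ∈ C ι ∨ ∃ s, T ∈ W s ∧ depth T s ≠ 0 := by
  rcases hT with hT | ⟨s, hT⟩
  · exact Or.inl hT
  · obtain ⟨t, ht⟩ := exists_ne s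
    by_cases h : depth T s = 0
    · left
      intro x
      by_cases hx : x = s
      · rw [hx]; exact hT.1
      · have := depth_of_mem_W hT hx
        omega
    · exact Or.inr ⟨s, hT, h⟩

theorem mem_C_iff (hT : T ∈ Sbar ι) : T ∈ C ι ↔ ∀ s, depth T s = 0 := by
  refine ⟨fun h => depth_of_mem_C h, fun h => ?_⟩
  rcases mem_C_or_depth_ne_zero hT with h' | ⟨s, _, h'⟩
  · exact h'
  · exact absurd (h s) h'

/-- Membership in an orthant depends only on the support, so it passes to points with smaller
support. -/
theorem mem_W_iff (hT : T ∈ Sbar ι) : T ∈ W s ↔ ∀ σ, coord T σ ≠ 0 → leg σ = s := by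
  refine ⟨fun h σ hσ => ?_, fun h => ?_⟩
  · by_contra hne
    exact hσ (coord_of_mem_W h hne)
  · rcases mem_C_or_depth_ne_zero hT with hC | ⟨t, hW, hd⟩
    · refine ⟨hC s, fun t t' ht ht' => ?_⟩
      have h1 : coord T (Sum.inl t) = 0 := by
        by_contra e; exact ht (h _ e)
      have h2 : coord T (Sum.inl t') = 0 := by
        by_contra e; exact ht' (h _ e)
      have := hC t
      have := hC t'
      simp only [coord_inl] at h1 h2
      omega
    · have : t = s := h (Sum.inr t) hd
      exact this ▸ hW

theorem coord_injOn (hT : T ∈ Sbar ι) (hT' : T' ∈ Sbar ι) (h : coord T = coord T') : T = T' := by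
  have hz : ∀ s, depth T s = depth T' s := fun s => congrFun h (Sum.inr s)
  have hx : ∀ s, max (T s) 0 = max (T' s) 0 := fun s => congrFun h (Sum.inl s)
  rcases mem_C_or_depth_ne_zero hT with hC | ⟨s, hW, hd⟩
  · have hC' : T' ∈ C ι := (mem_C_iff hT').2 fun s => (hz s).symm.trans (depth_of_mem_C hC s)
    funext s
    have := hC s
    have := hC' s
    have := hx s
    omega
  · have hW' : T' ∈ W s := mem_W_of_depth_ne_zero (hz s ▸ hd)
    funext t
    by_cases hts : t = s
    · subst hts
      have := hW.1
      have := hW'.1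
      have := hx t
      omega
    · have := depth_of_mem_W hW hts
      have := depth_of_mem_W hW' hts
      have := hz s
      omega

theorem compatible_of_coord_ne_zero (hT : T ∈ Sbar ι) {σ τ : ι ⊕ ι} (hσ : coord T σ ≠ 0)
    (hτ : coord T τ ≠ 0) : Compatible σ τ := by
  rcases mem_C_or_depth_ne_zero hT with hC | ⟨s, hW, hd⟩
  · left
    rcases σ with s | s
    · rcases τ with t | t
      · exact ⟨rfl, rfl⟩
      · exact absurd (depth_of_mem_C hC t) hτ
    · exact absurd (depth_of_mem_C hC s) hσ
  · exact Or.inr (((mem_W_iff hT).1 hW σ hσ).trans ((mem_W_iff hT).1 hW τ hτ).symm)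

theorem exists_coord_eq (f : ι ⊕ ι → ℤ) (hf : ∀ σ, 0 ≤ f σ)
    (hc : ∀ σ τ, f σ ≠ 0 → f τ ≠ 0 → Compatible σ τ) : ∃ T ∈ Sbar ι, coord T = f := by
  classical
  by_cases hz : ∃ s, f (Sum.inr s) ≠ 0
  · obtain ⟨s, hs⟩ := hz
    have h0 : ∀ σ, leg σ ≠ s → f σ = 0 := by
      intro σ hσ
      by_contra e
      rcases hc σ _ e hs with ⟨_, h⟩ | h
      · simp at h
      · exact hσ h
    have hW : (fun t => if t = s then f (Sum.inl s) else -f (Sum.inr s)) ∈ W s := by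
      refine ⟨by simpa using hf _, fun t t' ht ht' => ?_⟩
      simp only [ht, ht', if_false, true_and]
      have := hf (Sum.inr s)
      omega
    refine ⟨_, Or.inr ⟨s, hW⟩, funext fun σ => ?_⟩
    by_cases hσ : leg σ = s
    · rcases σ with t | t
      · obtain rfl : t = s := hσ
        simpa using hf _
      · obtain rfl : t = s := hσ
        obtain ⟨t', ht'⟩ := exists_ne t
        rw [coord_inr, depth_of_mem_W hW ht']
        simp [ht']
    · rw [coord_of_mem_W hW hσ, h0 σ hσ]
  · push Not at hz
    have hC : (fun s => f (Sum.inl s)) ∈ C ι := fun s => hf _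
    refine ⟨_, Or.inl hC, funext fun σ => ?_⟩
    rcases σ with s | s
    · simpa using hf _
    · rw [coord_inr, depth_of_mem_C hC, hz]

/-- An edge changes one `T_s` or one common value off `s`, that is, one grid coordinate. Replacing
the common value by its negative does not affect parity, so orientations agree. -/
theorem below_iff_coord (T T' : Sbar ι) : (sbarOriented ι).below T T' ↔
    ∃ σ, coord T.1 σ % 2 = 0 ∧ (coord T'.1 σ = coord T.1 σ + 1 ∨ coord T'.1 σ = coord T.1 σ - 1) ∧
      ∀ τ, τ ≠ σ → coord T.1 τ = coord T'.1 τ := by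
  obtain ⟨T, hT⟩ := T
  obtain ⟨T', hT'⟩ := T'
  constructor
  · rintro ⟨⟨-, hE⟩, hev⟩
    dsimp only at *
    have hone : ∀ s, |T s - T' s| = 1 → T s % 2 = 0 := fun s hs =>
      Int.even_iff.1 (hev s fun e => by simp [e] at hs)
    rcases hE with ⟨hC, hC', s, h1, h2⟩ | ⟨s, hW, hW', ⟨h1, h2⟩ | ⟨h1, h2⟩⟩
    · have e := hone s h1
      have := hC s
      have := hC' s
      refine ⟨Sum.inl s, ?_, ?_, fun τ hτ => ?_⟩
      · rw [coord_inl]; omega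
      · rw [coord_inl, coord_inl]
        rw [abs_eq (by norm_num)] at h1
        omega
      · rcases τ with t | t
        · rw [coord_inl, coord_inl, h2 t fun e => hτ (by rw [e])]
        · rw [coord_inr, coord_inr, depth_of_mem_C hC, depth_of_mem_C hC']
    · have e := hone s h1
      have := hW.1
      have := hW'.1
      refine ⟨Sum.inl s, ?_, ?_, fun τ hτ => ?_⟩
      · rw [coord_inl]; omega
      · rw [coord_inl, coord_inl]
        rw [abs_eq (by norm_num)] at h1
        omega
      · by_cases hl : leg τ = s
        · rcases τ with t | t
          · exact absurd (congrArg Sum.inl hl) hτ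
          · obtain rfl : t = s := hl
            obtain ⟨t', ht'⟩ := exists_ne t
            rw [coord_inr, coord_inr, depth_of_mem_W hW ht', depth_of_mem_W hW' ht', h2 t' ht']
        · rw [coord_of_mem_W hW hl, coord_of_mem_W hW' hl]
    · obtain ⟨t', ht'⟩ := exists_ne s
      have e := hone t' (h2 t' ht')
      have h3 := h2 t' ht'
      rw [abs_eq (by norm_num)] at h3
      refine ⟨Sum.inr s, ?_, ?_, fun τ hτ => ?_⟩
      · rw [coord_inr, depth_of_mem_W hW ht']; omega
      · rw [coord_inr, coord_inr, depth_of_mem_W hW ht', depth_of_mem_W hW' ht']; omega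
      · by_cases hl : leg τ = s
        · rcases τ with t | t
          · obtain rfl : t = s := hl
            rw [coord_inl, coord_inl, h1]
          · exact absurd (congrArg Sum.inr hl) hτ
        · rw [coord_of_mem_W hW hl, coord_of_mem_W hW' hl]
  · rintro ⟨σ, h1, h2, h3⟩
    have hne : T ≠ T' := by
      rintro rfl
      dsimp only at h2
      omega
    suffices H : (CEdge T T' ∨ ∃ s, WEdge s T T') ∧ ∀ s, T s ≠ T' s → Even (T s) from
      ⟨⟨fun e => hne (congrArg Subtype.val e), H.1⟩, H.2⟩
    dsimp only at *
    rcases σ with s | s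
    · have hz : ∀ t, depth T t = depth T' t := fun t => h3 (Sum.inr t) (by simp)
      have hx : ∀ t, t ≠ s → max (T t) 0 = max (T' t) 0 := fun t ht =>
        h3 (Sum.inl t) (by simpa using ht)
      rw [coord_inl] at h1 h2
      rw [coord_inl] at h2
      have fin : 0 ≤ T s → 0 ≤ T' s → (∀ t, t ≠ s → T t = T' t) →
          |T s - T' s| = 1 ∧ ∀ t, T t ≠ T' t → Even (T t) := by
        intro a1 a2 a3
        refine ⟨(abs_eq (by norm_num)).2 (by omega), fun t ht => ?_⟩
        obtain rfl : t = s := by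
          by_contra e; exact ht (a3 t e)
        exact Int.even_iff.2 (by omega)
      rcases mem_C_or_depth_ne_zero hT with hC | ⟨t, hW, hd⟩
      · have hC' : T' ∈ C ι := (mem_C_iff hT').2 fun s => (hz s).symm.trans (depth_of_mem_C hC s)
        have a3 : ∀ t, t ≠ s → T t = T' t := fun t ht => by
          have := hC t
          have := hC' t
          have := hx t ht
          omega
        obtain ⟨b1, b2⟩ := fin (hC s) (hC' s) a3
        exact ⟨Or.inl ⟨hC, hC', s, b1, a3⟩, b2⟩
      · have hW' : T' ∈ W t := mem_W_of_depth_ne_zero (hz t ▸ hd)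
        -- Inside `𝕎_t` a coordinate on another leg is constantly zero, so the moving coordinate
        -- belongs to `t`.
        obtain rfl : t = s := by
          by_contra e
          have c1 := coord_of_mem_W hW (σ := Sum.inl s) (Ne.symm e)
          have c2 := coord_of_mem_W hW' (σ := Sum.inl s) (Ne.symm e)
          rw [coord_inl] at c1 c2
          omega
        have a3 : ∀ x, x ≠ t → T x = T' x := fun x hx => by
          have := depth_of_mem_W hW hx
          have := depth_of_mem_W hW' hx
          have := hz t
          omega
        obtain ⟨b1, b2⟩ := fin hW.1 hW'.1 a3
        exact ⟨Or.inr ⟨t, hW, hW', Or.inl ⟨b1, a3⟩⟩, b2⟩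
    · rw [coord_inr] at h1 h2
      rw [coord_inr] at h2
      have key : T ∈ W s ∧ T' ∈ W s := by
        have hl : ∀ τ, leg τ ≠ s → τ ≠ Sum.inr s := fun τ hτ e => hτ (by rw [e]; rfl)
        -- At least one end has nonzero depth and so lies in `𝕎_s`. The other agrees with it on all
        -- other legs.
        by_cases hd : depth T s = 0
        · have hW' : T' ∈ W s := mem_W_of_depth_ne_zero (by omega)
          refine ⟨(mem_W_iff hT).2 fun τ hτ => ?_, hW'⟩
          by_contra e
          rw [h3 τ (hl τ e), coord_of_mem_W hW' e] at hτ
          exact hτ rfl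
        · have hW : T ∈ W s := mem_W_of_depth_ne_zero hd
          refine ⟨hW, (mem_W_iff hT').2 fun τ hτ => ?_⟩
          by_contra e
          rw [← h3 τ (hl τ e), coord_of_mem_W hW e] at hτ
          exact hτ rfl
      obtain ⟨hW, hW'⟩ := key
      have hs : T s = T' s := by
        have := h3 (Sum.inl s) (by simp)
        rw [coord_inl, coord_inl] at this
        have := hW.1
        have := hW'.1
        omega
      refine ⟨Or.inr ⟨s, hW, hW', Or.inr ⟨hs, fun t ht => ?_⟩⟩, fun t ht => ?_⟩
      · have := depth_of_mem_W hW ht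
        have := depth_of_mem_W hW' ht
        exact (abs_eq (by norm_num)).2 (by omega)
      · have hts : t ≠ s := by
          rintro rfl; exact ht hs
        have := depth_of_mem_W hW hts
        exact Int.even_iff.2 (by omega)

/-- The part of the extended subtree space supported on a set `Q` of legs is a flag orthant. -/
theorem isFlagOrthant_induce (A : Set (Sbar ι)) (Q : ι → Prop)
    (hA : ∀ T : Sbar ι, T ∈ A ↔ ∀ σ, coord T.1 σ ≠ 0 → Q (leg σ)) :
    ((sbarOriented ι).induce A).IsFlagOrthant
      (fun σ τ => Compatible σ τ ∧ Q (leg σ) ∧ Q (leg τ)) (fun T => coord T.1.1) where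
  symm := by
    rintro σ τ ⟨h1, h2, h3⟩
    exact ⟨h1.imp And.symm Eq.symm, h3, h2⟩
  inj T T' h := Subtype.ext (Subtype.ext (coord_injOn T.1.2 T'.1.2 h))
  nonneg T σ := coord_nonneg _ _
  compat T σ τ hσ hτ :=
    ⟨compatible_of_coord_ne_zero T.1.2 hσ hτ, (hA _).1 T.2 σ hσ, (hA _).1 T.2 τ hτ⟩
  surj f hf hR := by
    obtain ⟨T, hT, rfl⟩ := exists_coord_eq f hf fun σ τ hσ hτ => (hR σ τ hσ hτ).1
    exact ⟨⟨⟨T, hT⟩, (hA _).2 fun σ hσ => (hR σ σ hσ hσ).2.1⟩, rfl⟩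
  below_iff T T' := below_iff_coord T.1 T'.1

end Nontrivial

/-! ### Potentials as a flag orthant. -/

section Product

variable {V : Type*} {S : Finset V}

/-- The grid coordinates of a potential. -/
noncomputable def potCoord (p : Pot S) (a : V × (S ⊕ S)) : ℤ := coord (p.at a.1) a.2

/-- The pairs of grid coordinates of a potential that can be nonzero simultaneously. -/
def PotCompatible (S : Finset V) (a b : V × (S ⊕ S)) : Prop :=
  a.1 = b.1 → Compatible a.2 b.2 ∧ (∀ h : a.1 ∈ S, leg a.2 = ⟨a.1, h⟩) ∧
    ∀ h : a.1 ∈ S, leg b.2 = ⟨a.1, h⟩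

/-- The factor at a terminal is cut out by forbidding every leg but its own; at other nodes the same
condition is vacuous. -/
theorem potGraph_isFlagOrthant [Nontrivial S] :
    (potGraph S).IsFlagOrthant (PotCompatible S) potCoord :=
  OrientedGraph.IsFlagOrthant.pi (I := V) (K := S ⊕ S) fun i =>
    isFlagOrthant_induce (factor S i) (fun s => ∀ h : i ∈ S, s = ⟨i, h⟩) fun T =>
      ⟨fun hT σ hσ h => (mem_W_iff T.2).1 (hT h) σ hσ,
        fun hT h => (mem_W_iff T.2).2 fun σ hσ => hT σ hσ h⟩

end Product

end SubtreeSpace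

/-! ### The terms of the extended dual objective in grid coordinates -/

namespace SubtreeSpace

open OrientedGraph OrientedGraph.IsFlagOrthant

/-! ### Linear functions whose coefficients satisfy the sign condition. -/

section Coefficients

variable {ι : Type*} [DecidableEq ι]

/-- The coefficients of `-T_t` as a linear function of the grid coordinates of `T`. -/
def negCoef (t : ι) : ι ⊕ ι → ℤ :=
  Sum.elim (fun s => if s = t then -1 else 0) fun s => if s = t then 0 else 1

/-- The coefficients of the grid coordinate on `𝕎_t` that is constant off `t`. -/
def depthCoef (t : ι) : ι ⊕ ι → ℤ := Sum.elim (fun _ => 0) fun s => if s = t then 1 else 0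

/-- The coefficients of a linear function whose positive part is twice the size on `ℂ ∪ 𝕎_t`. -/
def sizeCoef (t : ι) : ι ⊕ ι → ℤ := Sum.elim (fun _ => 1) fun s => if s = t then -1 else 1

theorem negCoef_add_nonneg (t : ι) {σ τ : ι ⊕ ι} (h : ¬ Compatible σ τ) :
    0 ≤ negCoef t σ + negCoef t τ := by
  unfold Compatible at h
  rcases σ with s | s <;> rcases τ with s' | s' <;>
    simp only [negCoef, Sum.elim_inl, Sum.elim_inr, leg_inl, leg_inr, Sum.isLeft_inl] at h ⊢ <;>
    grind

theorem depthCoef_nonneg (t : ι) (σ : ι ⊕ ι) : 0 ≤ depthCoef t σ := by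
  rcases σ with s | s <;> simp only [depthCoef, Sum.elim_inl, Sum.elim_inr] <;> grind

theorem sizeCoef_add_nonneg (t : ι) {σ τ : ι ⊕ ι} (h : ¬ Compatible σ τ) :
    0 ≤ sizeCoef t σ + sizeCoef t τ := by
  unfold Compatible at h
  rcases σ with s | s <;> rcases τ with s' | s' <;>
    simp only [sizeCoef, Sum.elim_inl, Sum.elim_inr, leg_inl, leg_inr, Sum.isLeft_inl] at h ⊢ <;>
    grind

theorem sum_depthCoef [Fintype ι] (T : ι → ℤ) (t : ι) : ∑ σ, depthCoef t σ * coord T σ = depth T t := by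
  simp [depthCoef, Fintype.sum_sum_type]

end Coefficients

/-! ### Barrier, distance and size as positive parts of linear functions. -/

section Space

variable {ι : Type*} [Nontrivial ι] {T T' : ι → ℤ} {s t : ι}

theorem mem_C_of_support (hT : T ∈ Sbar ι) (hC : T' ∈ C ι)
    (h : ∀ σ, coord T' σ = 0 → coord T σ = 0) : T ∈ C ι :=
  (mem_C_iff hT).2 fun s => h (Sum.inr s) (depth_of_mem_C hC s)

theorem mem_W_of_support (hT : T ∈ Sbar ι) (hW : T' ∈ W s)
    (h : ∀ σ, coord T' σ = 0 → coord T σ = 0) : T ∈ W s :=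
  (mem_W_iff hT).2 fun σ hσ => by
    by_contra hne
    exact hσ (h σ (coord_of_mem_W hW hne))

theorem mem_C_or_mem_W_of_coord_ne_zero (hT : T ∈ Sbar ι) {σ : ι ⊕ ι} (hσ : coord T σ ≠ 0) :
    T ∈ C ι ∨ T ∈ W (leg σ) := by
  rcases mem_C_or_depth_ne_zero hT with hC | ⟨s, hW, _⟩
  · exact Or.inl hC
  · exact Or.inr ((mem_W_iff hT).1 hW σ hσ ▸ hW)

theorem max_neg_val_eq (x y : ℤ) (a : ℕ) :
    max (-val x - val y - a) 0 = ((max (-x - y + 2 * -(a : ℤ)) 0 : ℤ) : ℝ) / 2 := by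
  push_cast
  rw [← max_div_div_right (by norm_num : (0 : ℝ) ≤ 2)]
  unfold val
  congr 1 <;> ring

theorem barrier_eq (hT : T ∈ W t) :
    barrier T = ((max (depth T t - T t + 2 * 0) 0 : ℤ) : ℝ) / 2 := by
  obtain ⟨s, hs⟩ := exists_ne t
  have := max_neg_val_eq (T t) (T s) 0
  rw [barrier_of_mem_W hs.symm hT, depth_of_mem_W hT hs]
  simp only [Nat.cast_zero, sub_zero] at this
  rw [this]
  congr 4
  ring

theorem barrier_nonneg (hT : T ∈ Sbar ι) : 0 ≤ barrier T := by
  rcases mem_C_or_depth_ne_zero hT with hC | ⟨t, hW, _⟩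
  · rw [barrier_of_mem_C hC]
  · rw [barrier_eq hW]
    exact div_nonneg (Int.cast_nonneg (le_max_right _ _)) zero_le_two

/-- The two-term formula survives when `T` is not in `𝕎_t`: then `T` has depth zero on `t` and the
second term vanishes. -/
theorem dist_eq_of_mem_W_right (a : ℕ) (hT : T ∈ Sbar ι) (hT' : T' ∈ W t) :
    dist a T T' = ((max (depth T' t - T t + 2 * -(a : ℤ)) 0 +
      max (depth T t - T' t + 2 * -(a : ℤ)) 0 : ℤ) : ℝ) / 2 := by
  by_cases hW : T ∈ W t
  · obtain ⟨s, hs⟩ := exists_ne t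
    rw [dist_of_mem_W a hs.symm hW hT', max_neg_val_eq, max_neg_val_eq, depth_of_mem_W hW hs,
      depth_of_mem_W hT' hs]
    push_cast
    rw [← add_div]
    congr 3
    ring
  · obtain ⟨s, hs, h⟩ : ∃ s, s ≠ t ∧ (T ∈ C ι ∨ T ∈ W s) := by
      rcases hT with hC | ⟨s, hs⟩
      · obtain ⟨s, hs⟩ := exists_ne t
        exact ⟨s, hs, Or.inl hC⟩
      · exact ⟨s, fun e => hW (e ▸ hs), Or.inr hs⟩
    have hd : depth T t = 0 := by
      rcases h with h | h
      exacts [depth_of_mem_C h t, depth_of_mem_W_of_ne h hs.symm]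
    have h0 : max (depth T t - T' t + 2 * -(a : ℤ)) 0 = 0 := by
      have := hT'.1
      omega
    rw [dist_comm, dist_of_mem_W_left a hs.symm hT' h, max_neg_val_eq, h0, add_zero,
      depth_of_mem_W hT' hs]

theorem dist_eq (a : ℕ) (hT : T ∈ Sbar ι) (hT' : T' ∈ Sbar ι) (h : T ∈ W t ∨ T' ∈ W t) :
    dist a T T' = ((max (depth T' t - T t + 2 * -(a : ℤ)) 0 +
      max (depth T t - T' t + 2 * -(a : ℤ)) 0 : ℤ) : ℝ) / 2 := by
  rcases h with h | h
  · rw [dist_comm, dist_eq_of_mem_W_right a hT' h, add_comm]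
  · exact dist_eq_of_mem_W_right a hT h

theorem mem_C_or_exists_depth_ne_zero (hT : T ∈ Sbar ι) (hT' : T' ∈ Sbar ι) :
    (T ∈ C ι ∧ T' ∈ C ι) ∨ ∃ t, depth T t ≠ 0 ∨ depth T' t ≠ 0 := by
  rcases mem_C_or_depth_ne_zero hT with hC | ⟨t, _, hd⟩
  · rcases mem_C_or_depth_ne_zero hT' with hC' | ⟨t, _, hd⟩
    · exact Or.inl ⟨hC, hC'⟩
    · exact Or.inr ⟨t, Or.inr hd⟩
  · exact Or.inr ⟨t, Or.inl hd⟩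

theorem dist_nonneg (a : ℕ) (hT : T ∈ Sbar ι) (hT' : T' ∈ Sbar ι) : 0 ≤ dist a T T' := by
  rcases mem_C_or_exists_depth_ne_zero hT hT' with h | ⟨t, h⟩
  · rw [dist_of_mem_C a h.1 h.2]
  · rw [dist_eq a hT hT' (h.imp mem_W_of_depth_ne_zero mem_W_of_depth_ne_zero)]
    exact div_nonneg (Int.cast_nonneg (add_nonneg (le_max_right _ _) (le_max_right _ _)))
      zero_le_two

theorem dist_zero_eq (hT : T ∈ W t) : dist 0 0 T = (depth T t : ℝ) / 2 := by
  have h0 : (0 : ι → ℤ) ∈ C ι := fun _ => le_rfl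
  have hd := depth_nonneg T t
  have := hT.1
  rw [dist_eq_of_mem_W_right 0 (Or.inl h0) hT, depth_of_mem_C h0]
  congr 2
  simp only [Pi.zero_apply, Nat.cast_zero]
  omega

/-- The four points lie in one orthant, that of the top corner, and there `T_t` is a grid coordinate
or the negative of one. -/
theorem squarePos_apply {T₁ T₂ T₃ T₄ : ι → ℤ} (h₁ : T₁ ∈ Sbar ι) (h₂ : T₂ ∈ Sbar ι)
    (h₃ : T₃ ∈ Sbar ι) (h₄ : T₄ ∈ Sbar ι)
    (h : ∀ σ, SquarePos (coord T₁ σ) (coord T₂ σ) (coord T₃ σ) (coord T₄ σ)) (t : ι) :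
    SquarePos (T₁ t) (T₂ t) (T₃ t) (T₄ t) := by
  have s1 : ∀ σ, coord T₄ σ = 0 → coord T₁ σ = 0 ∧ coord T₂ σ = 0 ∧ coord T₃ σ = 0 := by
    intro σ hσ
    have := h σ
    unfold SquarePos ZigzagLE at this
    omega
  have hx := h (Sum.inl t)
  simp only [coord_inl] at hx
  rcases mem_C_or_depth_ne_zero h₄ with hC | ⟨s, hW, _⟩
  · have c1 := mem_C_of_support h₁ hC fun σ hσ => (s1 σ hσ).1
    have c2 := mem_C_of_support h₂ hC fun σ hσ => (s1 σ hσ).2.1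
    have c3 := mem_C_of_support h₃ hC fun σ hσ => (s1 σ hσ).2.2
    rwa [max_eq_left (c1 t), max_eq_left (c2 t), max_eq_left (c3 t), max_eq_left (hC t)] at hx
  · have c1 := mem_W_of_support h₁ hW fun σ hσ => (s1 σ hσ).1
    have c2 := mem_W_of_support h₂ hW fun σ hσ => (s1 σ hσ).2.1
    have c3 := mem_W_of_support h₃ hW fun σ hσ => (s1 σ hσ).2.2
    by_cases hts : t = s
    · subst hts
      rwa [max_eq_left c1.1, max_eq_left c2.1, max_eq_left c3.1, max_eq_left hW.1] at hx
    · have hz := (h (Sum.inr s)).neg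
      simpa only [coord_inr, depth_of_mem_W c1 hts, depth_of_mem_W c2 hts, depth_of_mem_W c3 hts,
        depth_of_mem_W hW hts, neg_neg] using hz

variable [Fintype ι] [DecidableEq ι]

theorem sum_negCoef (hT : T ∈ Sbar ι) (t : ι) : ∑ σ, negCoef t σ * coord T σ = -T t := by
  rw [Fintype.sum_sum_type]
  simp only [negCoef, Sum.elim_inl, Sum.elim_inr, coord_inl, coord_inr, ite_mul, neg_mul, one_mul,
    zero_mul, Finset.sum_ite_eq', Finset.mem_univ, if_true]
  rcases mem_C_or_depth_ne_zero hT with hC | ⟨s, hW, _⟩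
  · rw [Finset.sum_eq_zero fun x _ => by rw [depth_of_mem_C hC, ite_self], max_eq_left (hC t),
      add_zero]
  · rw [Finset.sum_eq_single s
      (fun x _ hx => by rw [depth_of_mem_W_of_ne hW hx, ite_self]) (by simp)]
    by_cases hst : s = t
    · subst hst
      rw [if_pos rfl, max_eq_left hW.1, add_zero]
    · rw [if_neg hst, max_eq_right (hW.2 t t (Ne.symm hst) (Ne.symm hst)).2,
        depth_of_mem_W hW (Ne.symm hst)]
      ring

/-- On `ℂ` the linear function is a sum of nonnegative terms, so its positive part changes nothing.
On `𝕎_t` it reduces to `T_t` minus the depth. The coefficient 1 on the other depths is invisible on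
both and serves the sign condition. -/
theorem size_eq (h : T ∈ C ι ∨ T ∈ W t) :
    size T = ((max (∑ σ, sizeCoef t σ * coord T σ + 0) 0 : ℤ) : ℝ) / 2 := by
  rw [Fintype.sum_sum_type]
  simp only [sizeCoef, Sum.elim_inl, Sum.elim_inr, coord_inl, coord_inr, one_mul, add_zero]
  rcases h with hC | hW
  · rw [size_of_mem_C hC, Finset.sum_eq_zero (s := Finset.univ)
      (f := fun s => (if s = t then -1 else 1) * depth T s)
      (fun x _ => by rw [depth_of_mem_C hC, mul_zero]), add_zero,
      Finset.sum_congr rfl fun x _ => max_eq_left (hC x),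
      max_eq_left (Finset.sum_nonneg fun x _ => hC x)]
    simp only [val]
    rw [← Finset.sum_div]
    push_cast
    rfl
  · obtain ⟨s, hs⟩ := exists_ne t
    rw [size_of_mem_W hs.symm hW, Finset.sum_eq_single t
      (fun x _ hx => max_eq_right (hW.2 x x hx hx).2) (by simp),
      Finset.sum_eq_single t
      (fun x _ hx => by rw [depth_of_mem_W_of_ne hW hx, mul_zero]) (by simp), if_pos rfl,
      max_eq_left hW.1, depth_of_mem_W hW hs]
    have := max_neg_val_eq (-T t) (-T s) 0
    simp only [Nat.cast_zero, sub_zero, val, Int.cast_neg] at this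
    unfold val
    convert this using 2
    · ring
    · congr 2
      ring

theorem size_nonneg (hT : T ∈ Sbar ι) : 0 ≤ size T := by
  obtain ⟨t, h⟩ : ∃ t, T ∈ C ι ∨ T ∈ W t := by
    rcases hT with h | ⟨t, h⟩
    · exact ⟨Classical.arbitrary ι, Or.inl h⟩
    · exact ⟨t, Or.inr h⟩
  rw [size_eq h]
  exact div_nonneg (Int.cast_nonneg (le_max_right _ _)) zero_le_two

end Space

end SubtreeSpace

/-! ### From local formulas to L-convexity. -/

namespace OrientedGraph

variable {α J : Type*} {G : OrientedGraph α} {R : J → J → Prop} {φ : α → J → ℤ}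

/-- L-convexity of a nonnegative function that coincides, near each node at which it is not
`flat`, with half of some member of a family `K` of integer-valued functions. -/
theorem CoordLConvex.of_local (h : G.IsFlagOrthant R φ) {I : Type*} {f : α → ℝ}
    (K : I → α → ℤ) (near : I → α → Prop) (flat : α → Prop)
    (hnear : ∀ t p, near t p → f p = (K t p : ℝ) / 2) (hflat : ∀ p, flat p → f p = 0)
    (hf : ∀ p, 0 ≤ f p)
    (hup : ∀ p, flat p ∨ ∃ t, ∀ q, (∀ k, φ p k ≠ 0 → φ q k ≠ 0) → near t q)
    (hdown : ∀ p, (∀ q, (∀ k, φ p k = 0 → φ q k = 0) → flat q) ∨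
      ∃ t, ∀ q, (∀ k, φ p k = 0 → φ q k = 0) → near t q)
    (hsquare : ∀ t u v m j, near t u → near t v → near t m → near t j →
      (∀ k, SquarePos (φ u k) (φ v k) (φ m k) (φ j k)) → K t m + K t j ≤ K t u + K t v)
    (hmeet : ∀ t u v m, G.IsMeetAntipodal u v m →
      ((G.rank m u : ℤ) + G.rank m v) * K t m ≤ G.rank m v * K t u + G.rank m u * K t v)
    (hjoin : ∀ t u v j, (∀ k, φ u k + φ v k = 2 * φ j k) → 2 * K t j ≤ K t u + K t v) :
    CoordLConvex G φ f where
  square u v m j hs := by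
    have e : ∀ k, φ j k = 0 → φ u k = 0 ∧ φ v k = 0 ∧ φ m k = 0 := fun k hk => by
      have := hs k
      unfold SquarePos ZigzagLE at this
      omega
    rcases hdown j with H | ⟨t, H⟩
    · rw [hflat u (H u fun k hk => (e k hk).1), hflat v (H v fun k hk => (e k hk).2.1),
        hflat m (H m fun k hk => (e k hk).2.2), hflat j (H j fun k hk => hk)]
    · have nu := H u fun k hk => (e k hk).1
      have nv := H v fun k hk => (e k hk).2.1
      have nm := H m fun k hk => (e k hk).2.2
      have nj := H j fun k hk => hk
      rw [hnear t u nu, hnear t v nv, hnear t m nm, hnear t j nj]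
      have : (K t m : ℝ) + K t j ≤ K t u + K t v := by
        exact_mod_cast hsquare t u v m j nu nv nm nj hs
      linarith
  meet u v m hm := by
    have h0 : (0 : ℝ) ≤ G.rank m u := Nat.cast_nonneg _
    have h1 : (0 : ℝ) ≤ G.rank m v := Nat.cast_nonneg _
    -- At a flat meet the left side is zero and nonnegativity suffices. Otherwise one formula is
    -- valid on every node whose support contains that of `m`, in particular at `u` and `v`.
    rcases hup m with H | ⟨t, H⟩
    · rw [hflat m H, mul_zero]
      exact add_nonneg (mul_nonneg h1 (hf u)) (mul_nonneg h0 (hf v))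
    · rw [hnear t u (H u fun k => (h.le_imp hm.2.2.1.1 k).ne_zero),
        hnear t v (H v fun k => (h.le_imp hm.2.2.1.2.1 k).ne_zero), hnear t m (H m fun k => id)]
      have : ((G.rank m u : ℝ) + G.rank m v) * K t m ≤
          G.rank m v * K t u + G.rank m u * K t v := by
        exact_mod_cast hmeet t u v m hm
      linarith
  join u v j hm hu hv := by
    rcases hdown j with H | ⟨t, H⟩
    · rw [hflat u (H u fun k hk => (hu k).eq_zero hk), hflat v (H v fun k hk => (hv k).eq_zero hk),
        hflat j (H j fun k hk => hk)]
      simp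
    · rw [hnear t u (H u fun k hk => (hu k).eq_zero hk),
        hnear t v (H v fun k hk => (hv k).eq_zero hk), hnear t j (H j fun k hk => hk)]
      have : 2 * (K t j : ℝ) ≤ K t u + K t v := by
        exact_mod_cast hjoin t u v j hm
      linarith

end OrientedGraph

/-! ### L-convexity of the individual terms. -/

namespace SubtreeSpace

open OrientedGraph OrientedGraph.IsFlagOrthant

variable {V : Type*} {S : Finset V}

/-- Two indices usable at the same terminal lie on the same leg, so a clash never comes from the
restriction of legs. -/
theorem not_compatible_of_not_potCompatible {a b : V × (S ⊕ S)} (ha : PotCompatible S a a)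
    (hb : PotCompatible S b b) (h : ¬ PotCompatible S a b) :
    a.1 = b.1 ∧ ¬ Compatible a.2 b.2 := by
  unfold PotCompatible at h
  push Not at h
  obtain ⟨e, h⟩ := h
  refine ⟨e, fun hc => ?_⟩
  obtain ⟨hS, h⟩ := h hc (ha rfl).2.1
  have := (hb rfl).2.1 (e ▸ hS)
  exact h (this.trans (Subtype.ext e.symm))

theorem Pot.at_mem (p : Pot S) (i : V) : p.at i ∈ Sbar S := (p i).1.2

theorem pair_square [Nontrivial S] {u v m j : Pot S}
    (hs : ∀ k, SquarePos (potCoord u k) (potCoord v k) (potCoord m k) (potCoord j k))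
    (i i' : V) (t : S) (c : ℤ) :
    max (depth (m.at i') t - m.at i t + 2 * c) 0 + max (depth (j.at i') t - j.at i t + 2 * c) 0 ≤
      max (depth (u.at i') t - u.at i t + 2 * c) 0 +
        max (depth (v.at i') t - v.at i t + 2 * c) 0 := by
  have h1 := hs (i', Sum.inr t)
  have h2 := squarePos_apply (u.at_mem i) (v.at_mem i) (m.at_mem i) (j.at_mem i)
    (fun σ => hs (i, σ)) t
  simpa only [potCoord, coord_inr, sub_eq_add_neg] using h1.kink_le h2.neg c

variable [DecidableEq V]

/-- The coefficients of `-(p_i)_t` plus the depth of `p_j` on the leg `t`. -/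
def pairCoef (i j : V) (t : S) (a : V × (S ⊕ S)) : ℤ :=
  (if a.1 = i then negCoef t a.2 else 0) + if a.1 = j then depthCoef t a.2 else 0

/-- The bound holds also for `i = j`, since `negCoef t` vanishes exactly where `depthCoef t` does
not overlap it: at the depth of the leg `t`. -/
theorem pairCoef_cases (i j : V) (t : S) (a : V × (S ⊕ S)) :
    pairCoef i j t a = -1 ∨ pairCoef i j t a = 0 ∨ pairCoef i j t a = 1 := by
  rcases a with ⟨k, s | s⟩ <;>
    simp only [pairCoef, negCoef, depthCoef, Sum.elim_inl, Sum.elim_inr] <;> grind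

theorem pairCoef_add_nonneg (i j : V) (t : S) {a b : V × (S ⊕ S)} (ha : PotCompatible S a a)
    (hb : PotCompatible S b b) (h : ¬ PotCompatible S a b) :
    0 ≤ pairCoef i j t a + pairCoef i j t b := by
  obtain ⟨e, hc⟩ := not_compatible_of_not_potCompatible ha hb h
  have h1 := negCoef_add_nonneg t hc
  have h2 := depthCoef_nonneg t a.2
  have h3 := depthCoef_nonneg t b.2
  unfold pairCoef
  rw [e]
  split_ifs <;> omega

theorem sum_ite_node [Fintype V] (i : V) (α : S ⊕ S → ℤ) (p : Pot S) :
    ∑ a : V × (S ⊕ S), (if a.1 = i then α a.2 else 0) * potCoord p a =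
      ∑ σ, α σ * coord (p.at i) σ := by
  rw [Fintype.sum_prod_type, Finset.sum_eq_single i]
  · simp [potCoord]
  · intro k _ hk
    simp [hk]
  · simp

variable [Nontrivial S]

theorem lin_pairCoef [Fintype V] (i j : V) (t : S) (p : Pot S) :
    lin potCoord (pairCoef i j t) p = depth (p.at j) t - p.at i t := by
  unfold lin pairCoef
  simp only [add_mul, Finset.sum_add_distrib, sum_ite_node, sum_depthCoef]
  rw [sum_negCoef (p.at_mem i)]
  ring

theorem pair_meet [Fintype V] {u v m : Pot S} (h : (potGraph S).IsMeetAntipodal u v m)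
    (i j : V) (t : S) (c : ℤ) :
    (((potGraph S).rank m u : ℤ) + (potGraph S).rank m v) *
        max (depth (m.at j) t - m.at i t + c) 0 ≤
      (potGraph S).rank m v * max (depth (u.at j) t - u.at i t + c) 0 +
        (potGraph S).rank m u * max (depth (v.at j) t - v.at i t + c) 0 := by
  have := potGraph_isFlagOrthant.kink_of_isMeetAntipodal (pairCoef_cases i j t)
    (fun a b => pairCoef_add_nonneg i j t) c h
  simpa only [lin_pairCoef] using this

theorem pair_join [Fintype V] {u v m : Pot S}
    (h : ∀ k, potCoord u k + potCoord v k = 2 * potCoord m k) (i j : V) (t : S) (c : ℤ) :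
    2 * max (depth (m.at j) t - m.at i t + c) 0 ≤
      max (depth (u.at j) t - u.at i t + c) 0 + max (depth (v.at j) t - v.at i t + c) 0 := by
  have := kink_midpoint (pairCoef i j t) c h
  simpa only [lin_pairCoef] using this

variable [Fintype V]

theorem coordLConvex_dist (a : ℕ) (i j : V) :
    CoordLConvex (potGraph S) potCoord fun p => dist a (p.at i) (p.at j) := by
  refine CoordLConvex.of_local potGraph_isFlagOrthant
    (fun t p => max (depth (p.at j) t - p.at i t + 2 * -(a : ℤ)) 0 +
      max (depth (p.at i) t - p.at j t + 2 * -(a : ℤ)) 0)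
    (fun t p => p.at i ∈ W t ∨ p.at j ∈ W t) (fun p => p.at i ∈ C S ∧ p.at j ∈ C S)
    (fun t p h => dist_eq a (p.at_mem i) (p.at_mem j) h) (fun p h => dist_of_mem_C a h.1 h.2)
    (fun p => dist_nonneg a (p.at_mem i) (p.at_mem j)) (fun p => ?_) (fun p => ?_)
    (fun t u v m w _ _ _ _ hs => ?_) (fun t u v m h => ?_) (fun t u v m h => ?_)
  · refine (mem_C_or_exists_depth_ne_zero (p.at_mem i) (p.at_mem j)).imp_right ?_
    rintro ⟨t, h⟩
    exact ⟨t, fun q hq => h.imp (fun h => mem_W_of_depth_ne_zero (hq (i, Sum.inr t) h))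
      fun h => mem_W_of_depth_ne_zero (hq (j, Sum.inr t) h)⟩
  · rcases mem_C_or_exists_depth_ne_zero (p.at_mem i) (p.at_mem j) with ⟨h1, h2⟩ | ⟨t, h⟩
    · exact Or.inl fun q hq => ⟨mem_C_of_support (q.at_mem i) h1 fun σ => hq (i, σ),
        mem_C_of_support (q.at_mem j) h2 fun σ => hq (j, σ)⟩
    · exact Or.inr ⟨t, fun q hq => h.imp
        (fun h => mem_W_of_support (T' := p.at i) (q.at_mem i) (mem_W_of_depth_ne_zero h)
          fun σ => hq (i, σ))
        fun h => mem_W_of_support (T' := p.at j) (q.at_mem j) (mem_W_of_depth_ne_zero h)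
          fun σ => hq (j, σ)⟩
  · have h1 := pair_square hs i j t (-(a : ℤ))
    have h2 := pair_square hs j i t (-(a : ℤ))
    linarith
  · have h1 := pair_meet h i j t (2 * -(a : ℤ))
    have h2 := pair_meet h j i t (2 * -(a : ℤ))
    linarith
  · have h1 := pair_join h i j t (2 * -(a : ℤ))
    have h2 := pair_join h j i t (2 * -(a : ℤ))
    linarith

theorem coordLConvex_barrier (i : V) :
    CoordLConvex (potGraph S) potCoord fun p => barrier (p.at i) := by
  refine CoordLConvex.of_local potGraph_isFlagOrthant
    (fun t p => max (depth (p.at i) t - p.at i t + 2 * 0) 0)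
    (fun t p => p.at i ∈ W t) (fun p => p.at i ∈ C S)
    (fun t p h => barrier_eq h) (fun p h => barrier_of_mem_C h)
    (fun p => barrier_nonneg (p.at_mem i)) (fun p => ?_) (fun p => ?_)
    (fun t u v m w _ _ _ _ hs => pair_square hs i i t 0) (fun t u v m h => pair_meet h i i t _)
    (fun t u v m h => pair_join h i i t _)
  · refine (mem_C_or_depth_ne_zero (p.at_mem i)).imp_right ?_
    rintro ⟨t, _, h⟩
    exact ⟨t, fun q hq => mem_W_of_depth_ne_zero (hq (i, Sum.inr t) h)⟩
  · rcases mem_C_or_depth_ne_zero (p.at_mem i) with h | ⟨t, h, _⟩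
    · exact Or.inl fun q hq => mem_C_of_support (q.at_mem i) h fun σ => hq (i, σ)
    · exact Or.inr ⟨t, fun q hq => mem_W_of_support (q.at_mem i) h fun σ => hq (i, σ)⟩

theorem coordLConvex_size (i : V) :
    CoordLConvex (potGraph S) potCoord fun p => size (p.at i) := by
  have hlin : ∀ (t : S) (p : Pot S), lin potCoord (fun a => if a.1 = i then sizeCoef t a.2 else 0) p
      = ∑ σ, sizeCoef t σ * coord (p.at i) σ := fun t p => sum_ite_node i (sizeCoef t) p
  refine CoordLConvex.of_local potGraph_isFlagOrthant
    (fun t p => max (∑ σ, sizeCoef t σ * coord (p.at i) σ + 0) 0)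
    (fun t p => p.at i ∈ C S ∨ p.at i ∈ W t) (fun p => ∀ σ, coord (p.at i) σ = 0)
    (fun t p h => size_eq h) (fun p h => ?_)
    (fun p => size_nonneg (p.at_mem i)) (fun p => ?_) (fun p => Or.inr ?_)
    (fun t u v m j _ _ _ hj hs => ?_) (fun t u v m h => ?_) (fun t u v m h => ?_)
  · have hC : p.at i ∈ C S := (mem_C_iff (p.at_mem i)).2 fun s => h (Sum.inr s)
    rw [size_eq (t := Classical.arbitrary S) (Or.inl hC), Finset.sum_eq_zero fun σ _ => by
      rw [h σ, mul_zero]]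
    simp
  -- The zero vector singles out no leg, but the size vanishes there. A nonzero coordinate confines
  -- all points of larger support to `ℂ` and one `𝕎_t`.
  · by_cases h : ∀ σ, coord (p.at i) σ = 0
    · exact Or.inl h
    · push Not at h
      obtain ⟨σ, hσ⟩ := h
      exact Or.inr ⟨leg σ, fun q hq => mem_C_or_mem_W_of_coord_ne_zero (q.at_mem i) (hq (i, σ) hσ)⟩
  · rcases p.at_mem i with h | ⟨t, h⟩
    · exact ⟨Classical.arbitrary S, fun q hq =>
        Or.inl (mem_C_of_support (q.at_mem i) h fun σ => hq (i, σ))⟩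
    · exact ⟨t, fun q hq => Or.inr (mem_W_of_support (q.at_mem i) h fun σ => hq (i, σ))⟩
  · have e : ∀ σ, coord (j.at i) σ = 0 →
        coord (u.at i) σ = 0 ∧ coord (v.at i) σ = 0 ∧ coord (m.at i) σ = 0 := fun σ hσ => by
      have : SquarePos (coord (u.at i) σ) (coord (v.at i) σ) (coord (m.at i) σ)
        (coord (j.at i) σ) := hs (i, σ)
      unfold SquarePos ZigzagLE at this
      omega
    rcases hj with hC | hW
    -- When the join lies in `ℂ` the kink is inactive at all four corners, so the function is
    -- additive over the square.
    · have hz : ∀ p : Pot S, p.at i ∈ C S →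
          0 ≤ ∑ σ, sizeCoef t σ * coord (p.at i) σ := by
        intro p hp
        refine Finset.sum_nonneg fun σ _ => ?_
        rcases σ with s | s
        · simp [sizeCoef]
        · simp [depth_of_mem_C hp]
      have hu := hz u (mem_C_of_support (u.at_mem i) hC fun σ hσ => (e σ hσ).1)
      have hv := hz v (mem_C_of_support (v.at_mem i) hC fun σ hσ => (e σ hσ).2.1)
      have hm := hz m (mem_C_of_support (m.at_mem i) hC fun σ hσ => (e σ hσ).2.2)
      have hj := hz j hC
      have : ∑ σ, sizeCoef t σ * coord (m.at i) σ + ∑ σ, sizeCoef t σ * coord (j.at i) σ =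
          ∑ σ, sizeCoef t σ * coord (u.at i) σ + ∑ σ, sizeCoef t σ * coord (v.at i) σ := by
        rw [← Finset.sum_add_distrib, ← Finset.sum_add_distrib]
        refine Finset.sum_congr rfl fun σ _ => ?_
        have : SquarePos (coord (u.at i) σ) (coord (v.at i) σ) (coord (m.at i) σ)
          (coord (j.at i) σ) := hs (i, σ)
        rcases this.1 with ⟨e1, e2⟩ | ⟨e1, e2⟩ <;> rw [e1, e2]
        ring
      omega
    · have hl : ∀ p : Pot S, p.at i ∈ W t →
          ∑ σ, sizeCoef t σ * coord (p.at i) σ = p.at i t + -depth (p.at i) t := by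
        intro p hp
        rw [Fintype.sum_sum_type, Finset.sum_eq_single t
          (fun x _ hx => by rw [coord_of_mem_W hp (σ := Sum.inl x) hx, mul_zero]) (by simp),
          Finset.sum_eq_single t
          (fun x _ hx => by rw [coord_of_mem_W hp (σ := Sum.inr x) hx, mul_zero]) (by simp),
          coord_inl, max_eq_left hp.1]
        simp [sizeCoef]
      rw [hl u (mem_W_of_support (u.at_mem i) hW fun σ hσ => (e σ hσ).1),
        hl v (mem_W_of_support (v.at_mem i) hW fun σ hσ => (e σ hσ).2.1),
        hl m (mem_W_of_support (m.at_mem i) hW fun σ hσ => (e σ hσ).2.2), hl j hW]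
      have h2 := squarePos_apply (u.at_mem i) (v.at_mem i) (m.at_mem i) (j.at_mem i)
        (fun σ => hs (i, σ)) t
      exact h2.kink_le (hs (i, Sum.inr t)).neg 0
  · have := potGraph_isFlagOrthant.kink_of_isMeetAntipodal
      (l := fun a => if a.1 = i then sizeCoef t a.2 else 0)
      (fun a => by rcases a with ⟨k, s | s⟩ <;> simp only [sizeCoef, Sum.elim_inl, Sum.elim_inr] <;>
        grind)
      (fun a b ha hb hab => by
        obtain ⟨e, hc⟩ := not_compatible_of_not_potCompatible ha hb hab
        have := sizeCoef_add_nonneg t hc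
        rw [e]
        split_ifs <;> omega) 0 h
    simpa only [hlin] using this
  · have := kink_midpoint (fun a => if a.1 = i then sizeCoef t a.2 else 0) 0 h
    simpa only [hlin] using this

theorem coordLConvex_neg_dist_zero {i : V} (hi : i ∈ S) :
    CoordLConvex (potGraph S) potCoord fun p => -dist 0 0 (p.at i) := by
  have hd : ∀ p : Pot S, dist 0 0 (p.at i) = (potCoord p (i, Sum.inr ⟨i, hi⟩) : ℝ) / 2 :=
    fun p => dist_zero_eq ((p i).2 hi)
  simp only [hd]
  refine ⟨fun u v m j hs => ?_, fun u v m hm => ?_, fun u v j h _ _ => ?_⟩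
  · rcases (hs (i, Sum.inr ⟨i, hi⟩)).1 with ⟨e1, e2⟩ | ⟨e1, e2⟩ <;> rw [e1, e2]
    rw [add_comm]
  · have hlin : ∀ p : Pot S, lin potCoord (fun a => if a = (i, Sum.inr ⟨i, hi⟩) then -1 else 0) p
        = -potCoord p (i, Sum.inr ⟨i, hi⟩) := fun p => by simp [lin]
    have := potGraph_isFlagOrthant.lin_of_isMeetAntipodal
      (l := fun a => if a = (i, Sum.inr ⟨i, hi⟩) then -1 else 0)
      (fun a => by split_ifs <;> simp)
      (fun a b ha hb hab => by
        obtain ⟨e, hc⟩ := not_compatible_of_not_potCompatible ha hb hab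
        -- Clashes occur only at nonterminal nodes, where this linear function has zero
        -- coefficients; so even the concave sign in front of the distance is harmless.
        have key : a.1 ∉ S := fun hS => hc (Or.inr (((ha rfl).2.1 hS).trans
          ((Subtype.ext e).trans ((hb rfl).2.1 (e ▸ hS)).symm)))
        have ha' : a ≠ (i, Sum.inr ⟨i, hi⟩) := fun h => key (by rw [h]; exact hi)
        have hb' : b ≠ (i, Sum.inr ⟨i, hi⟩) := fun h => key (by rw [e, h]; exact hi)
        simp [ha', hb']) hm
    rw [hlin, hlin, hlin] at this
    have : (((potGraph S).rank m u : ℝ) + (potGraph S).rank m v) *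
        -potCoord m (i, Sum.inr ⟨i, hi⟩) ≤
        (potGraph S).rank m v * -potCoord u (i, Sum.inr ⟨i, hi⟩) +
        (potGraph S).rank m u * -potCoord v (i, Sum.inr ⟨i, hi⟩) := by
      exact_mod_cast this
    linarith
  · have := h (i, Sum.inr ⟨i, hi⟩)
    have : (potCoord u (i, Sum.inr ⟨i, hi⟩) : ℝ) + potCoord v (i, Sum.inr ⟨i, hi⟩) =
        2 * potCoord j (i, Sum.inr ⟨i, hi⟩) := by exact_mod_cast this
    linarith

theorem coordLConvex_edgeDist (a : ℕ) (e : Sym2 V) :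
    CoordLConvex (potGraph S) potCoord fun p => edgeDist p a e := by
  induction e with
  | h i j => exact coordLConvex_dist a i j

theorem coordLConvex_hTilde (E : SimpleGraph V) [DecidableRel E.Adj] (u a : Sym2 V → ℕ)
    (c r : V → ℕ) {M : ℝ} (hM : 0 ≤ M) :
    CoordLConvex (potGraph S) potCoord (hTilde E S u a c r M) := by
  have h1 : CoordLConvex (potGraph S) potCoord
      fun p => -∑ s ∈ S, (r s : ℝ) * dist 0 0 (p.at s) := by
    have := CoordLConvex.sum (s := S) fun s hs =>
      (coordLConvex_neg_dist_zero hs).const_mul (Nat.cast_nonneg (α := ℝ) (r s))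
    simpa only [mul_neg, Finset.sum_neg_distrib] using this
  have h2 := CoordLConvex.sum (s := Sᶜ) fun i _ =>
    (coordLConvex_size (S := S) i).const_mul (Nat.cast_nonneg (α := ℝ) (c i))
  have h3 := CoordLConvex.sum (s := E.edgeFinset) fun e _ =>
    (coordLConvex_edgeDist (S := S) (a e) e).const_mul (Nat.cast_nonneg (α := ℝ) (u e))
  have h4 := CoordLConvex.sum (s := S) fun s _ =>
    (coordLConvex_barrier (S := S) s).add (coordLConvex_size s)
  have h5 := CoordLConvex.sum (s := Sᶜ) fun i _ => coordLConvex_barrier (S := S) i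
  exact ((h1.add h2).add h3).add ((h4.add h5).const_mul hM)

end SubtreeSpace

theorem proposition4p5 {V : Type*} [Fintype V] [DecidableEq V]
    (E : SimpleGraph V) [DecidableRel E.Adj]
    (S : Finset V) (hS : 3 ≤ S.card)
    (u a : Sym2 V → ℕ) (ha : ∀ e ∈ E.edgeSet, 0 < a e)
    (c : V → ℕ) (r : V → ℕ) :
    (SubtreeSpace.potGraph S).IsWellOrientedMedian ∧
      ∃ M₀ : ℝ, ∀ M : ℝ, M₀ ≤ M →
        (SubtreeSpace.potGraph S).LConvex (SubtreeSpace.hTilde E S u a c r M) := by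
  have : Nontrivial S := Finset.one_lt_card_iff_nontrivial.1 (by omega) |>.coe_sort
  -- The penalty terms are L-convex by themselves, so `M₀ = 0` works.
  exact ⟨SubtreeSpace.potGraph_isFlagOrthant.isWellOrientedMedian, 0, fun M hM =>
    SubtreeSpace.potGraph_isFlagOrthant.lConvex (SubtreeSpace.coordLConvex_hTilde E u a c r hM)⟩
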